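/- **Proposition (Existence of the GARCH model).** *Setting.* Let $(\Omega,\mathcal A,\mathbb P)$ be a probability space, let $r,s\ge 0$ be integers, and let $(\zeta_i)_{i\in\mathbb Z}$ be i.i.d. real random variables with $\mathbb E\zeta_0=0$, $\mathbb E\zeta_0^2=1$. For $\theta=(\alpha_0,\alpha_1,\dots,\alpha_r,\beta_1,\dots,\beta_s)$ consider the GARCH$(r,s)$ recursion $$X_i^2=\zeta_i^2\sigma_i^2,\qquad \sigma_i^2=\alpha_0+\sum_{j=1}^r\alpha_jX_{i-j}^2+\sum_{k=1}^s\beta_k\sigma_{i-k}^2\qquad(i\in\mathbb Z)\tag{1}$$ where the unknowns are real random variables $X_i^2$ and $\sigma_i^2\ge 0$, and the equations hold almost surely. Put $f(\theta)=(\alpha_1,\dots,\alpha_r,\beta_1,\dots,\beta_s)'$ and let $A_i(\theta)$ be the $(r+s)\times(r+s)$ matrix with rows $\zeta_i^2f(\theta)',e_1',\dots,e_{r-1}'$ (the first $r$ rows) and $f(\theta)',e_{r+1}',\dots,e_{r+s-1}'$ (the last $s$ rows), where $e_j$ is the $j$-th unit vector. With $|\cdot|_2$ the spectral norm and $\log 0=-\infty$,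 let $\gamma(\theta)\in[-\infty,\infty)$ be the top Lyapunov exponent $$\gamma(\theta)=\lim_{n\to\infty}\tfrac1n\log|A_n(\theta)A_{n-1}(\theta)\cdots A_1(\theta)|_2\quad\text{a.s.}$$ *Assumption.* - (A1) $\zeta_0^2$ is not almost surely constant. - (A2) $\alpha_{\min}>0$, the set $\Theta$ is a compact subset of $$\tilde\Theta=\Big\{\theta\in\mathbb R_{\ge0}^{r+s+1}:\ \alpha_0\ge\alpha_{\min},\ \gamma(\theta)<0,\ \sum_{k=1}^s\beta_k<1\Big\},$$ and $\theta^*\in\operatorname{int}(\Theta)$, the interior being taken in $\mathbb R^{r+s+1}$. - (A3) If $s>0$, then the polynomials $\mathcal A_{\theta^*}(z)=\sum_{j=1}^r\alpha_j^*z^j$ and $\mathcal B_{\theta^*}(z)=1-\sum_{k=1}^s\beta_k^*z^k$ have no common root in $\mathbb C$, $\mathcal A_{\theta^*}(1)\ne0$ (so that $r\ge1$), and $\alpha_r^*+\beta_s^*\ne0$. *Notation.* Let $\mathcal F_i=(\zeta_i,\zeta_{i-1},\dots)$ and $\|Z\|_q=(\mathbb E|Z|^q)^{1/q}$ for $q>0$.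 A process indexed by $\mathbb Z$ is (strictly) stationary if its law is invariant under time shifts. For a process $X_i^2=H(\mathcal F_i)$ and an integer $k\ge 0$, the functional dependence measure is $\delta_q(k)=\|H(\mathcal F_k)-H(\mathcal F_k^*)\|_q$, where $\mathcal F_k^*$ arises from $\mathcal F_k$ by replacing $\zeta_0$ with an independent copy $\zeta_0^*$ that is independent of $(\zeta_i)_{i\in\mathbb Z}$. *Claim.* Under this assumption, the following holds for every $\theta\in\Theta$ (in particular for $\theta=\theta^*$). 1. The recursion (1) has a unique stationary solution, and it is causal: there are measurable functions $H,G:\mathbb R^{\mathbb N}\to\mathbb R$ such that $X_i^2=H(\mathcal F_i)$, $\sigma_i^2=G(\mathcal F_{i-1})$ solve (1) and form a jointly stationary process. Every solution $(X_i^2,\sigma_i^2)_{i\in\mathbb Z}$ of (1) with $(X_i^2)_{i\in\mathbb Z}$ stationary satisfies $X_i^2=H(\mathcal F_i)$ and $\sigma_i^2=G(\mathcal F_{i-1})$ almost surely for every $i\in\mathbb Z$. 2. For the solution in 1 there is $q>0$ such that $\|X_0^2\|_q<\infty$ and, for some $c\in(0,1)$ and $C>0$, $\delta_q(k)\le C\,c^k$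 for all $k\ge0$. 3. The $s\times s$ matrix $$B(\theta)=\begin{pmatrix}\beta_1&\beta_2&\cdots&\cdots&\beta_s\\1&0&\cdots&\cdots&0\\0&1&0&\cdots&0\\\vdots&\ddots&\ddots&\ddots&\vdots\\0&\cdots&0&1&0\end{pmatrix}$$ has spectral radius (largest modulus of a complex eigenvalue; $0$ if $s=0$) strictly less than $1$. -/

import Mathlib

open MeasureTheory ProbabilityTheory Filter Topology

namespace GarchModel

/-- Parameter vectors `θ = (α₀, (α₁, …, α_r), (β₁, …, β_s)) ∈ ℝ^{r+s+1}`.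
Indices are shifted by one: the entry `j : Fin r` of the second component is `α_{j+1}`, and the
entry `k : Fin s` of the third component is `β_{k+1}`. The topology is that of `ℝ^{r+s+1}`. -/
abbrev Param (r s : ℕ) : Type := ℝ × (Fin r → ℝ) × (Fin s → ℝ)

namespace Param

variable {r s : ℕ}

/-- The coefficient `α₀`. -/
def a0 (θ : Param r s) : ℝ := θ.1

/-- The coefficients `α₁, …, α_r`. -/
def α (θ : Param r s) : Fin r → ℝ := θ.2.1

/-- The coefficients `β₁, …, β_s`. -/
def β (θ : Param r s) : Fin s → ℝ := θ.2.2

/-- `f(θ) = (α₁, …, α_r, β₁, …, β_s)`; the disjoint sum of `Fin r` and `Fin s` plays the role of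
the index set `{1, …, r + s}`. -/
def f (θ : Param r s) : Fin r ⊕ Fin s → ℝ := Sum.elim θ.α θ.β

/-- The polynomial function `𝒜_θ(z) = ∑_{j=1}^r α_j z^j`. -/
noncomputable def polyA (θ : Param r s) (z : ℂ) : ℂ :=
  ∑ j : Fin r, (θ.α j : ℂ) * z ^ ((j : ℕ) + 1)

/-- The polynomial function `ℬ_θ(z) = 1 - ∑_{k=1}^s β_k z^k`. -/
noncomputable def polyB (θ : Param r s) (z : ℂ) : ℂ :=
  1 - ∑ k : Fin s, (θ.β k : ℂ) * z ^ ((k : ℕ) + 1)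

/-- The `s × s` matrix `B(θ)` with first row `(β₁, …, β_s)`, ones on the subdiagonal and zeros
elsewhere. -/
def companionB (θ : Param r s) : Matrix (Fin s) (Fin s) ℝ :=
  fun i j => if (i : ℕ) = 0 then θ.β j else if (i : ℕ) = (j : ℕ) + 1 then 1 else 0

/-- The matrix `A_i(θ)` as a function of the value `z` of the innovation `ζ_i`. Its rows are
`z² f(θ), e₁, …, e_{r-1}` (the first block) and `f(θ), e_{r+1}, …, e_{r+s-1}` (the second). -/
def matA (θ : Param r s) (z : ℝ) : Matrix (Fin r ⊕ Fin s) (Fin r ⊕ Fin s) ℝ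
  | Sum.inl i, b =>
      if (i : ℕ) = 0 then z ^ 2 * θ.f b
      else Sum.elim (fun j : Fin r => if (i : ℕ) = (j : ℕ) + 1 then (1 : ℝ) else 0)
        (fun _ : Fin s => 0) b
  | Sum.inr i, b =>
      if (i : ℕ) = 0 then θ.f b
      else Sum.elim (fun _ : Fin r => 0)
        (fun j : Fin s => if (i : ℕ) = (j : ℕ) + 1 then (1 : ℝ) else 0) b

/-- The product `A_n(θ) A_{n-1}(θ) ⋯ A_1(θ)` along a sequence `x` of innovations. -/
def prodA (θ : Param r s) (x : ℤ → ℝ) : ℕ → Matrix (Fin r ⊕ Fin s) (Fin r ⊕ Fin s) ℝ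
  | 0 => 1
  | n + 1 => θ.matA (x ((n : ℤ) + 1)) * prodA θ x n

end Param

/-- The spectral norm of a real square matrix: its operator norm for the Euclidean norm. -/
noncomputable def matSpectralNorm {ι : Type*} [Fintype ι] [DecidableEq ι] (M : Matrix ι ι ℝ) : ℝ :=
  ‖Matrix.toEuclideanCLM (𝕜 := ℝ) M‖

section Processes

variable {Ω : Type*} [MeasurableSpace Ω]

/-- `g ∈ [-∞, ∞]` is the top Lyapunov exponent `γ(θ)`: almost surely,
`(1/n) log |A_n(θ) A_{n-1}(θ) ⋯ A_1(θ)|₂ → g` as `n → ∞`, where `log 0 = -∞`. -/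
def HasTopLyapunovExponent {r s : ℕ} (P : Measure Ω) (ζ : ℤ → Ω → ℝ) (θ : Param r s)
    (g : EReal) : Prop :=
  ∀ᵐ ω ∂P, Tendsto
    (fun n : ℕ => (((n : ℝ)⁻¹ : ℝ) : EReal) *
      ENNReal.log (ENNReal.ofReal (matSpectralNorm (θ.prodA (fun i => ζ i ω) n))))
    atTop (𝓝 g)

/-- The i.i.d. innovations of the model: mean zero and unit variance, with a non-degenerate
square. -/
structure IsInnovation (P : Measure Ω) (ζ : ℤ → Ω → ℝ) : Prop where
  measurable : ∀ i, Measurable (ζ i)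
  indep : iIndepFun ζ P
  identDistrib : ∀ i, IdentDistrib (ζ i) (ζ 0) P P
  integrable_sq : Integrable (fun ω => ζ 0 ω ^ 2) P
  mean_zero : ∫ ω, ζ 0 ω ∂P = 0
  mean_sq : ∫ ω, ζ 0 ω ^ 2 ∂P = 1
  nondegenerate : ¬ ∃ c : ℝ, ∀ᵐ ω ∂P, ζ 0 ω ^ 2 = c

/-- The set of all `θ ∈ ℝ_{≥ 0}^{r+s+1}` with `α₀ ≥ α_min`, `γ(θ) < 0` and `∑ β_k < 1`. -/
def admissibleParams (r s : ℕ) (P : Measure Ω) (ζ : ℤ → Ω → ℝ) (αmin : ℝ) :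
    Set (Param r s) :=
  {θ | 0 ≤ θ.a0 ∧ (∀ j, 0 ≤ θ.α j) ∧ (∀ k, 0 ≤ θ.β k) ∧ αmin ≤ θ.a0 ∧
    (∃ g : EReal, HasTopLyapunovExponent P ζ θ g ∧ g < 0) ∧ ∑ k, θ.β k < 1}

/-- The standing assumption on the innovations `ζ`, the compact parameter set `Θ` and the true
parameter `θ*`. -/
structure StandingAssumption {r s : ℕ} (P : Measure Ω) (ζ : ℤ → Ω → ℝ) (αmin : ℝ)
    (Θ : Set (Param r s)) (θstar : Param r s) : Prop where
  innovation : IsInnovation P ζ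
  αmin_pos : 0 < αmin
  subset : Θ ⊆ admissibleParams r s P ζ αmin
  compact : IsCompact Θ
  mem_interior : θstar ∈ interior Θ
  no_common_root : 0 < s → ∀ z : ℂ, ¬ (θstar.polyA z = 0 ∧ θstar.polyB z = 0)
  polyA_one : 0 < s → θstar.polyA 1 ≠ 0
  last_coeff : ∀ (hr : 0 < r) (hs : 0 < s),
    θstar.α ⟨r - 1, Nat.sub_lt hr one_pos⟩ + θstar.β ⟨s - 1, Nat.sub_lt hs one_pos⟩ ≠ 0

/-- The processes `X2 = (X_i²)` and `σ2 = (σ_i²)` of random variables solve the GARCH(r, s)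
recursion with innovations `ζ` and constant parameter `θ`. -/
structure IsGarchSolution {r s : ℕ} (P : Measure Ω) (ζ : ℤ → Ω → ℝ) (θ : Param r s)
    (X2 σ2 : ℤ → Ω → ℝ) : Prop where
  aemeasurable_X2 : ∀ i, AEMeasurable (X2 i) P
  aemeasurable_σ2 : ∀ i, AEMeasurable (σ2 i) P
  nonneg : ∀ i, ∀ᵐ ω ∂P, 0 ≤ σ2 i ω
  observation : ∀ i, ∀ᵐ ω ∂P, X2 i ω = ζ i ω ^ 2 * σ2 i ω
  volatility : ∀ i, ∀ᵐ ω ∂P, σ2 i ω = θ.a0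
    + ∑ j : Fin r, θ.α j * X2 (i - ((j : ℕ) + 1)) ω
    + ∑ k : Fin s, θ.β k * σ2 (i - ((k : ℕ) + 1)) ω

/-- Strict stationarity: the law of the whole process is invariant under time shifts. -/
def IsStrictlyStationary {E : Type*} [MeasurableSpace E] (P : Measure Ω) (Y : ℤ → Ω → E) : Prop :=
  ∀ h : ℤ, IdentDistrib (fun ω (i : ℤ) => Y (i + h) ω) (fun ω (i : ℤ) => Y i ω) P P

/-- The sequence `(x_i, x_{i-1}, x_{i-2}, …)`; for `x = ζ(ω)` this is `ℱ_i(ω)`. -/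
def past (x : ℤ → ℝ) (i : ℤ) : ℕ → ℝ := fun j => x (i - j)

/-- The process `h(ℱ_i)`, `i ∈ ℤ`. -/
def causal (ζ : ℤ → Ω → ℝ) (h : (ℕ → ℝ) → ℝ) (i : ℤ) (ω : Ω) : ℝ :=
  h (past (fun n => ζ n ω) i)

/-- The functional dependence measure `δ_q(k) = ‖h(ℱ_k) - h(ℱ_k^*)‖_q` of the process
`h(ℱ_i)`, where `ℱ_k^*` is `ℱ_k` with `ζ_0` replaced by an independent copy `ζ_0^*`. The copy is
realised as the second coordinate on the product of `Ω` with the law of `ζ_0`. For `q > 0`,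
`eLpNorm Z q` is `(𝔼 |Z|^q)^{1/q}`, also when `q < 1`. -/
noncomputable def functionalDependence (P : Measure Ω) (ζ : ℤ → Ω → ℝ) (h : (ℕ → ℝ) → ℝ)
    (q : ℝ) (k : ℕ) : ENNReal :=
  eLpNorm
    (fun p : Ω × ℝ => h (past (fun n => ζ n p.1) k)
      - h (past (Function.update (fun n => ζ n p.1) 0 p.2) k))
    (ENNReal.ofReal q) (P.prod (P.map (ζ 0)))

end Processes

end GarchModel

/-! Stack present and lagged values into Z_i = (X_i², …, σ_i², …). The recursion becomes Z_i =
b(ζ_i) + A(ζ_i) Z_{i-1}, whose causal solution should be the series of A(ζ_i) ⋯ A(ζ_{i-n+1})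
b(ζ_{i-n}) over n ≥ 0. Everything rests on the decay of these products.

A negative Lyapunov exponent makes the n-fold product smaller than ρ^n with probability tending to
one, for some ρ < 1. This yields a small moment of some n-fold product below one
(`exists_prodMoment_lt_one`): the exponent 1/n turns the product of norms into a geometric mean,
whose expectation is bounded uniformly in n because ζ has a second moment, and a further square root
controls the rare event that the product is large. Moments of independent blocks are
submultiplicative, so they decay geometrically (`exists_prodMoment_le_geometric`). Since x ↦ x^q is
subadditive for q ≤ 1, the series has a finite q-th moment and converges almost surely, which gives
existence and moments. Replacing one innovation k steps back changes the state by a product of about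
k matrices applied to a difference with finite q-th moment, which gives geometric dependence.

For uniqueness, the difference of two solutions at time i is the n-fold product applied to their
difference at time i - n. The first factor vanishes in probability, so tightness of the second
suffices. Only X² is assumed stationary; tightness of σ² is `isTightFamily_volatility`: a large
volatility persists at a lag with β_k > 0, and a non-small innovation soon makes it visible in X².

The bound on the spectral radius follows from ∑ β_k < 1 by comparing the entries of an eigenvector.
-/

namespace GarchModel

/-! ### A submultiplicative matrix norm. -/

section EntrySum

variable {ι : Type*} [Fintype ι]

/-- The sum of the absolute values of the entries of a square matrix. -/
def entrySum (M : Matrix ι ι ℝ) : ℝ := ∑ i, ∑ j, |M i j|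

theorem entrySum_nonneg (M : Matrix ι ι ℝ) : 0 ≤ entrySum M :=
  Finset.sum_nonneg fun _ _ => Finset.sum_nonneg fun _ _ => abs_nonneg _

theorem row_le_entrySum (M : Matrix ι ι ℝ) (i : ι) : ∑ j, |M i j| ≤ entrySum M :=
  Finset.single_le_sum (f := fun i => ∑ j, |M i j|)
    (fun _ _ => Finset.sum_nonneg fun _ _ => abs_nonneg _) (Finset.mem_univ i)

theorem entrySum_mul_le (M N : Matrix ι ι ℝ) : entrySum (M * N) ≤ entrySum M * entrySum N := by
  unfold entrySum
  rw [Finset.sum_mul]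
  refine Finset.sum_le_sum fun i _ => ?_
  rw [Finset.sum_mul]
  calc ∑ j, |(M * N) i j| ≤ ∑ j, ∑ k, |M i k| * |N k j| := by
        refine Finset.sum_le_sum fun j _ => ?_
        rw [Matrix.mul_apply]
        refine (Finset.abs_sum_le_sum_abs _ _).trans (le_of_eq ?_)
        simp only [abs_mul]
    _ = ∑ k, |M i k| * ∑ j, |N k j| := by
        rw [Finset.sum_comm]
        simp only [Finset.mul_sum]
    _ ≤ ∑ k, |M i k| * ∑ i, ∑ j, |N i j| := by
        refine Finset.sum_le_sum fun k _ => mul_le_mul_of_nonneg_left ?_ (abs_nonneg _)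
        exact row_le_entrySum N k

theorem abs_mulVec_le (M : Matrix ι ι ℝ) (v : ι → ℝ) (i : ι) :
    |(M.mulVec v) i| ≤ entrySum M * ‖v‖ := by
  calc |(M.mulVec v) i| ≤ ∑ j, |M i j| * ‖v‖ := by
        rw [Matrix.mulVec, dotProduct]
        refine (Finset.abs_sum_le_sum_abs _ _).trans (Finset.sum_le_sum fun j _ => ?_)
        rw [abs_mul]
        exact mul_le_mul_of_nonneg_left (norm_le_pi_norm v j) (abs_nonneg _)
    _ ≤ entrySum M * ‖v‖ := by
        rw [← Finset.sum_mul]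
        exact mul_le_mul_of_nonneg_right (row_le_entrySum M i) (norm_nonneg _)

theorem norm_mulVec_le (M : Matrix ι ι ℝ) (v : ι → ℝ) :
    ‖M.mulVec v‖ ≤ entrySum M * ‖v‖ :=
  (pi_norm_le_iff_of_nonneg (mul_nonneg (entrySum_nonneg _) (norm_nonneg _))).2
    fun i => abs_mulVec_le M v i

theorem abs_entry_le_matSpectralNorm [DecidableEq ι] (M : Matrix ι ι ℝ) (i j : ι) :
    |M i j| ≤ matSpectralNorm M := by
  have h1 : (Matrix.toEuclideanCLM (𝕜 := ℝ) M (EuclideanSpace.single j 1)) i = M i j := by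
    simp [Matrix.ofLp_toEuclideanCLM]
  rw [← h1, ← Real.norm_eq_abs]
  refine (PiLp.norm_apply_le _ i).trans ?_
  refine (ContinuousLinearMap.le_opNorm _ _).trans ?_
  simp [matSpectralNorm]

/-- One direction of norm equivalence is enough, because the Lyapunov exponent enters only as an
upper bound on products. -/
theorem entrySum_le_matSpectralNorm [DecidableEq ι] (M : Matrix ι ι ℝ) :
    entrySum M ≤ (Fintype.card ι : ℝ) ^ 2 * matSpectralNorm M := by
  calc entrySum M ≤ ∑ _i : ι, ∑ _j : ι, matSpectralNorm M :=
        Finset.sum_le_sum fun i _ => Finset.sum_le_sum fun j _ =>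
          abs_entry_le_matSpectralNorm M i j
    _ = _ := by simp [pow_two, mul_assoc]

end EntrySum

/-! ### Pasts of the innovations and matrix products along them. -/

/-- The sequence `y` without its first `m` terms. -/
def drop (m : ℕ) (y : ℕ → ℝ) : ℕ → ℝ := fun j => y (m + j)

theorem past_zero (x : ℤ → ℝ) (i : ℤ) : past x i 0 = x i := by simp [past]

theorem drop_past (x : ℤ → ℝ) (i : ℤ) (m : ℕ) : drop m (past x i) = past x (i - m) := by
  funext j; simp only [drop, past]; congr 1; push_cast; ring

theorem drop_drop (m n : ℕ) (y : ℕ → ℝ) : drop m (drop n y) = drop (n + m) y := by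
  funext j; simp only [drop]; congr 1; ring

namespace Param

variable {r s : ℕ}

/-- The inhomogeneous term `α₀ (z², 0, …, 0, 1, 0, …, 0)` of the state space recursion. -/
def shock (θ : Param r s) (z : ℝ) : Fin r ⊕ Fin s → ℝ :=
  Sum.elim (fun i => if (i : ℕ) = 0 then z ^ 2 * θ.a0 else 0)
    (fun i => if (i : ℕ) = 0 then θ.a0 else 0)

/-- The product `A(y₀) A(y₁) ⋯ A(y_{n-1})`. -/
def pastProd (θ : Param r s) : (ℕ → ℝ) → ℕ → Matrix (Fin r ⊕ Fin s) (Fin r ⊕ Fin s) ℝ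
  | _, 0 => 1
  | y, n + 1 => θ.matA (y 0) * pastProd θ (drop 1 y) n

theorem pastProd_succ (θ : Param r s) (y : ℕ → ℝ) (n : ℕ) :
    θ.pastProd y (n + 1) = θ.matA (y 0) * θ.pastProd (drop 1 y) n := rfl

theorem pastProd_add (θ : Param r s) (y : ℕ → ℝ) (m n : ℕ) :
    θ.pastProd y (m + n) = θ.pastProd y m * θ.pastProd (drop m y) n := by
  induction m generalizing y with
  | zero =>
    have : drop 0 y = y := by funext j; simp [drop]
    simp [pastProd, this]
  | succ m ih =>
    rw [Nat.add_right_comm, pastProd_succ, pastProd_succ, ih, drop_drop, Matrix.mul_assoc,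
      Nat.add_comm 1 m]

theorem pastProd_congr (θ : Param r s) {y y' : ℕ → ℝ} {n : ℕ} (h : ∀ j < n, y j = y' j) :
    θ.pastProd y n = θ.pastProd y' n := by
  induction n generalizing y y' with
  | zero => rfl
  | succ n ih =>
    rw [pastProd_succ, pastProd_succ, h 0 (by omega),
      ih (y := drop 1 y) (y' := drop 1 y') fun j hj => h (1 + j) (by omega)]

/-- The newest matrix stands leftmost, so a product running forward up to time n is a function of
the past seen from n. This lets its law be computed from that of the past. -/
theorem prodA_eq_pastProd (θ : Param r s) (x : ℤ → ℝ) (n : ℕ) :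
    θ.prodA x n = θ.pastProd (past x n) n := by
  induction n with
  | zero => rfl
  | succ n ih =>
    rw [prodA, pastProd_succ, past_zero, drop_past, ih]
    push_cast
    simp

/-- A constant `K` with `entrySum (A(z)) ≤ K (1 + z²)`. -/
def matBound (θ : Param r s) : ℝ := ∑ _i : Fin r ⊕ Fin s, ∑ j, (1 + |θ.f j|)

theorem matBound_nonneg (θ : Param r s) : 0 ≤ θ.matBound :=
  Finset.sum_nonneg fun _ _ => Finset.sum_nonneg fun _ _ => by positivity

theorem abs_matA_le (θ : Param r s) (z : ℝ) (i j : Fin r ⊕ Fin s) :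
    |θ.matA z i j| ≤ (1 + |θ.f j|) * (1 + z ^ 2) := by
  have h0 := abs_nonneg (θ.f j)
  have hz := sq_nonneg z
  have key : 1 ≤ (1 + |θ.f j|) * (1 + z ^ 2) := by nlinarith [mul_nonneg h0 hz]
  have key0 : 0 ≤ (1 + |θ.f j|) * (1 + z ^ 2) := by linarith
  rcases i with i | i
  · simp only [matA]
    split_ifs with h
    · rw [abs_mul, abs_of_nonneg hz]; nlinarith [mul_nonneg h0 hz]
    · rcases j with j | j
      · simp only [Sum.elim_inl]; split_ifs <;> simpa using by assumption
      · simpa using key0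
  · simp only [matA]
    split_ifs with h
    · nlinarith [mul_nonneg h0 hz]
    · rcases j with j | j
      · simpa using key0
      · simp only [Sum.elim_inr]; split_ifs <;> simpa using by assumption

theorem entrySum_matA_le (θ : Param r s) (z : ℝ) :
    entrySum (θ.matA z) ≤ θ.matBound * (1 + z ^ 2) := by
  unfold entrySum matBound
  rw [Finset.sum_mul]
  refine Finset.sum_le_sum fun i _ => ?_
  rw [Finset.sum_mul]
  exact Finset.sum_le_sum fun j _ => abs_matA_le θ z i j

theorem norm_shock_le (θ : Param r s) (z : ℝ) : ‖θ.shock z‖ ≤ |θ.a0| * (1 + z ^ 2) := by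
  have hz := sq_nonneg z
  have h0 := abs_nonneg θ.a0
  have key0 : 0 ≤ |θ.a0| * (1 + z ^ 2) := by positivity
  refine (pi_norm_le_iff_of_nonneg key0).2 fun i => ?_
  rw [Real.norm_eq_abs]
  rcases i with i | i
  · simp only [shock, Sum.elim_inl]
    split_ifs
    · rw [abs_mul, abs_of_nonneg hz]; nlinarith
    · simpa using key0
  · simp only [shock, Sum.elim_inr]
    split_ifs
    · nlinarith
    · simpa using key0

/-- The empty product is excluded: `entrySum 1` is the dimension, which may exceed one. -/
theorem entrySum_pastProd_le (θ : Param r s) (y : ℕ → ℝ) {n : ℕ} (hn : 0 < n) :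
    entrySum (θ.pastProd y n) ≤ ∏ j ∈ Finset.range n, entrySum (θ.matA (y j)) := by
  obtain ⟨n, rfl⟩ : ∃ m, n = m + 1 := ⟨n - 1, by omega⟩
  clear hn
  induction n generalizing y with
  | zero => simp [pastProd]
  | succ n ih =>
    rw [pastProd_succ, Finset.prod_range_succ']
    refine (entrySum_mul_le _ _).trans ?_
    rw [mul_comm]
    refine mul_le_mul_of_nonneg_right ((ih (drop 1 y)).trans (le_of_eq ?_)) (entrySum_nonneg _)
    refine Finset.prod_congr rfl fun j _ => ?_
    simp only [drop, Nat.add_comm 1 j]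

@[fun_prop]
theorem measurable_matA (θ : Param r s) (i j : Fin r ⊕ Fin s) :
    Measurable fun z => θ.matA z i j := by
  rcases i with i | i
  · simp only [matA]; split_ifs <;> fun_prop
  · simp only [matA]; split_ifs <;> fun_prop

@[fun_prop]
theorem measurable_shock (θ : Param r s) (i : Fin r ⊕ Fin s) :
    Measurable fun z => θ.shock z i := by
  rcases i with i | i
  · simp only [shock, Sum.elim_inl]; split_ifs <;> fun_prop
  · simp only [shock, Sum.elim_inr]; split_ifs <;> fun_prop

end Param

@[fun_prop]
theorem measurable_drop (m : ℕ) : Measurable (drop m) :=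
  measurable_pi_lambda _ fun j => measurable_pi_apply (m + j)

theorem measurable_past (i : ℤ) : Measurable fun x : ℤ → ℝ => past x i :=
  measurable_pi_lambda _ fun j => measurable_pi_apply (i - j)

namespace Param

variable {r s : ℕ}

theorem measurable_pastProd (θ : Param r s) (n : ℕ) (i j : Fin r ⊕ Fin s) :
    Measurable fun y => θ.pastProd y n i j := by
  induction n generalizing i j with
  | zero => simp only [pastProd]; exact measurable_const
  | succ n ih =>
    simp only [pastProd_succ, Matrix.mul_apply]
    refine Finset.measurable_sum _ fun k _ => ?_
    exact ((θ.measurable_matA i k).comp (measurable_pi_apply 0)).mul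
      ((ih k j).comp (measurable_drop 1))

theorem measurable_entrySum_pastProd (θ : Param r s) (n : ℕ) :
    Measurable fun y => entrySum (θ.pastProd y n) :=
  Finset.measurable_sum _ fun i _ => Finset.measurable_sum _ fun j _ =>
    (θ.measurable_pastProd n i j).abs

end Param

end GarchModel

namespace GarchModel

/-! ### I.i.d. sequences: independence of head and tail, laws of pasts. -/

section SeqLaw

/-- The law of an i.i.d. sequence with marginal `μ`. -/
noncomputable abbrev seqLaw (μ : Measure ℝ) : Measure (ℕ → ℝ) := Measure.infinitePi fun _ => μ

variable (μ : Measure ℝ) [IsProbabilityMeasure μ]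

theorem map_eval_seqLaw (j : ℕ) : (seqLaw μ).map (fun y => y j) = μ :=
  Measure.infinitePi_map_eval (fun _ => μ) j

/-- The sequence starting with the first `m` terms of `p.1` and continuing with `p.2`. -/
def splice (m : ℕ) (p : (ℕ → ℝ) × (ℕ → ℝ)) : ℕ → ℝ :=
  fun j => if j < m then p.1 j else p.2 (j - m)

theorem measurable_splice (m : ℕ) : Measurable (splice m) := by
  refine measurable_pi_lambda _ fun j => ?_
  simp only [splice]
  split_ifs <;> fun_prop

theorem drop_splice (m : ℕ) (p : (ℕ → ℝ) × (ℕ → ℝ)) : drop m (splice m p) = p.2 := by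
  funext j; simp [drop, splice]

/-- It suffices to test finite cylinders. The preimage of a cylinder is a rectangle: indices below m
constrain the first sequence, the others, shifted back by m, the second. -/
theorem map_splice_seqLaw (m : ℕ) :
    ((seqLaw μ).prod (seqLaw μ)).map (splice m) = seqLaw μ := by
  refine Measure.eq_infinitePi _ fun s t ht => ?_
  rw [Measure.map_apply (measurable_splice m)
    (MeasurableSet.pi s.countable_toSet fun i _ => ht i)]
  have hpre : splice m ⁻¹' (Set.pi s t) =
      (Set.pi (s.filter (· < m)) t) ×ˢ
        (Set.pi ((s.filter (m ≤ ·)).image (· - m)) fun j => t (m + j)) := by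
    ext p
    simp only [Set.mem_preimage, Set.mem_pi, Set.mem_prod, splice, SetLike.mem_coe,
      Finset.mem_filter, Finset.mem_image]
    constructor
    · intro h
      refine ⟨fun i hi => by simpa [hi.2] using h i hi.1, ?_⟩
      rintro j ⟨i, hi, rfl⟩
      have := h i hi.1
      rw [if_neg (by omega)] at this
      rwa [Nat.add_sub_cancel' hi.2]
    · rintro ⟨h1, h2⟩ i hi
      split_ifs with him
      · exact h1 i ⟨hi, him⟩
      · have := h2 (i - m) ⟨i, ⟨hi, by omega⟩, rfl⟩
        rwa [Nat.add_sub_cancel' (by omega)] at this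
  rw [hpre, Measure.prod_prod, Measure.infinitePi_pi _ fun i _ => ht i,
    Measure.infinitePi_pi _ fun i _ => ht _, Finset.prod_image]
  · rw [← Finset.prod_filter_mul_prod_filter_not s (· < m)]
    simp only [not_lt]
    congr 1
    refine Finset.prod_congr rfl fun i hi => ?_
    rw [Nat.add_sub_cancel' (Finset.mem_filter.1 hi).2]
  · intro i hi j hj hij
    simp only [Finset.coe_filter, Set.mem_ofPred_eq] at hi hj
    simp only at hij
    omega

/-- The first `m` terms of an i.i.d. sequence are independent of the remaining ones. -/
theorem lintegral_mul_comp_drop (m : ℕ) {F G : (ℕ → ℝ) → ENNReal}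
    (hF : Measurable F) (hG : Measurable G)
    (hdep : ∀ y y' : ℕ → ℝ, (∀ j < m, y j = y' j) → F y = F y') :
    ∫⁻ y, F y * G (drop m y) ∂(seqLaw μ) = (∫⁻ y, F y ∂(seqLaw μ)) * ∫⁻ y, G y ∂(seqLaw μ) := by
  -- After splicing, `F` sees only the first sequence and `G ∘ drop m` only the second, so Tonelli
  -- separates them.
  conv_lhs => rw [← map_splice_seqLaw μ m]
  have hFG : Measurable fun y => F y * G (drop m y) := hF.mul (hG.comp (measurable_drop m))
  rw [lintegral_map hFG (measurable_splice m),
    ← lintegral_prod_mul hF.aemeasurable hG.aemeasurable]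
  refine lintegral_congr fun p => ?_
  rw [drop_splice, hdep (splice m p) p.1 fun j hj => by simp [splice, hj]]

theorem lintegral_comp_eval (j : ℕ) {g : ℝ → ENNReal} (hg : Measurable g) :
    ∫⁻ y, g (y j) ∂(seqLaw μ) = ∫⁻ z, g z ∂μ := by
  conv_rhs => rw [← map_eval_seqLaw μ j]
  rw [lintegral_map hg (measurable_pi_apply j)]

end SeqLaw

namespace IsInnovation

variable {Ω : Type*} [MeasurableSpace Ω] {P : Measure Ω} {ζ : ℤ → Ω → ℝ}

theorem isProbabilityMeasure_law [IsProbabilityMeasure P] (h : IsInnovation P ζ) : IsProbabilityMeasure (P.map (ζ 0)) :=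
  Measure.isProbabilityMeasure_map (h.measurable 0).aemeasurable

theorem measurable_path (h : IsInnovation P ζ) : Measurable fun ω (i : ℤ) => ζ i ω :=
  measurable_pi_lambda _ h.measurable

theorem map_path (h : IsInnovation P ζ) :
    P.map (fun ω (i : ℤ) => ζ i ω) = Measure.infinitePi fun _ : ℤ => P.map (ζ 0) := by
  rw [h.indep.map_fun_eq_infinitePi_map h.measurable]
  congr 1
  funext i
  exact (h.identDistrib i).map_eq

/-- One statement covers pasts, time shifts and the sparse sets of times in the tightness argument.
-/
theorem map_comp_path [IsProbabilityMeasure P] (h : IsInnovation P ζ) {κ : Type*} {f : κ → ℤ} (hf : f.Injective) :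
    P.map (fun ω (i : κ) => ζ (f i) ω) = Measure.infinitePi fun _ : κ => P.map (ζ 0) := by
  have := h.isProbabilityMeasure_law
  have hm : Measurable fun (x : ℤ → ℝ) (i : κ) => x (f i) :=
    measurable_pi_lambda _ fun i => measurable_pi_apply (f i)
  rw [← Measure.map_infinitePi_infinitePi_of_inj (P := fun _ : ℤ => P.map (ζ 0)) hf,
    ← h.map_path, Measure.map_map hm h.measurable_path]
  rfl

theorem map_past [IsProbabilityMeasure P] (h : IsInnovation P ζ) (i : ℤ) :
    P.map (fun ω => past (fun n => ζ n ω) i) = seqLaw (P.map (ζ 0)) :=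
  h.map_comp_path (f := fun j : ℕ => i - j) fun a b hab => by
    simpa using hab

theorem measurable_past_path (h : IsInnovation P ζ) (i : ℤ) :
    Measurable fun ω => past (fun n => ζ n ω) i :=
  (measurable_past i).comp h.measurable_path

/-- Every functional of the shifted innovations has the law of the same functional of the
innovations. -/
theorem isStrictlyStationary_comp [IsProbabilityMeasure P] (h : IsInnovation P ζ) {E : Type*} [MeasurableSpace E]
    {g : (ℕ → ℝ) → E} (hg : Measurable g) :
    IsStrictlyStationary P fun i ω => g (past (fun n => ζ n ω) i) := by
  intro k
  have hΦ : Measurable fun (x : ℤ → ℝ) (i : ℤ) => g (past x i) :=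
    measurable_pi_lambda _ fun i => hg.comp (measurable_past i)
  have hshift : (fun ω (i : ℤ) => g (past (fun n => ζ n ω) (i + k))) =
      (fun (x : ℤ → ℝ) (i : ℤ) => g (past x i)) ∘ fun ω (i : ℤ) => ζ (i + k) ω := by
    funext ω i
    simp only [Function.comp]
    congr 1
    funext j
    exact congrArg (fun n => ζ n ω) (by ring)
  have hms : Measurable fun ω (i : ℤ) => ζ (i + k) ω :=
    measurable_pi_lambda _ fun i => h.measurable _
  refine ⟨?_, (hΦ.comp h.measurable_path).aemeasurable, ?_⟩
  · rw [hshift]; exact (hΦ.comp hms).aemeasurable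
  · have h2 : (fun ω (i : ℤ) => g (past (fun n => ζ n ω) i)) =
      (fun (x : ℤ → ℝ) (i : ℤ) => g (past x i)) ∘ fun ω (i : ℤ) => ζ i ω := rfl
    rw [hshift, h2, ← Measure.map_map hΦ hms, ← Measure.map_map hΦ h.measurable_path, h.map_path,
      h.map_comp_path (f := fun i => i + k) fun a b hab => by simpa using hab]

theorem lintegral_sq (h : IsInnovation P ζ) :
    ∫⁻ z, ENNReal.ofReal (z ^ 2) ∂(P.map (ζ 0)) = 1 := by
  rw [lintegral_map (by fun_prop) (h.measurable 0),
    ← ofReal_integral_eq_lintegral_ofReal h.integrable_sq (ae_of_all _ fun _ => sq_nonneg _),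
    h.mean_sq, ENNReal.ofReal_one]

end IsInnovation

end GarchModel

/-! ### Geometric decay of small moments of the matrix products. -/

namespace GarchModel

/-- A submultiplicative sequence with a term less than one decays geometrically. -/
theorem exists_geometric_bound {a : ℕ → ENNReal} (hsub : ∀ m n, a (m + n) ≤ a m * a n)
    (hfin : ∀ n, a n ≠ ⊤) {N : ℕ} (hN : 0 < N) (hlt : a N < 1) :
    ∃ C c : ℝ, 0 ≤ C ∧ 0 < c ∧ c < 1 ∧ ∀ n, a n ≤ ENNReal.ofReal (C * c ^ n) := by
  -- The lower bound 1/2 keeps the ratio positive even if `a N = 0`.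
  set b : ℝ := max (a N).toReal (1 / 2) with hb
  have hb0 : 0 < b := lt_of_lt_of_le (by norm_num) (le_max_right _ _)
  have hb1 : b < 1 := max_lt (by
    rw [← ENNReal.toReal_one]
    exact ENNReal.toReal_strict_mono ENNReal.one_ne_top hlt) (by norm_num)
  have haN : a N ≤ ENNReal.ofReal b := by
    rw [← ENNReal.ofReal_toReal (hfin N)]
    exact ENNReal.ofReal_le_ofReal (le_max_left _ _)
  set D : ℝ := ∑ l ∈ Finset.range N, (a l).toReal with hD
  have hD0 : 0 ≤ D := Finset.sum_nonneg fun _ _ => ENNReal.toReal_nonneg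
  have hDl : ∀ l < N, a l ≤ ENNReal.ofReal D := fun l hl => by
    rw [← ENNReal.ofReal_toReal (hfin l)]
    exact ENNReal.ofReal_le_ofReal (Finset.single_le_sum (f := fun l => (a l).toReal)
      (fun _ _ => ENNReal.toReal_nonneg) (Finset.mem_range.2 hl))
  have hblock : ∀ k l, l < N → a (N * k + l) ≤ ENNReal.ofReal (D * b ^ k) := by
    intro k l hl
    induction k with
    | zero => simpa using hDl l hl
    | succ k ih =>
      have : N * (k + 1) + l = N + (N * k + l) := by ring
      rw [this]
      calc a (N + (N * k + l)) ≤ a N * a (N * k + l) := hsub _ _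
        _ ≤ ENNReal.ofReal b * ENNReal.ofReal (D * b ^ k) := mul_le_mul' haN ih
        _ = ENNReal.ofReal (D * b ^ (k + 1)) := by
          rw [← ENNReal.ofReal_mul hb0.le]; congr 1; ring
  have hNr : (0 : ℝ) < N := by exact_mod_cast hN
  -- The factor `b⁻¹` pays for rounding: b^⌊n/N⌋ ≤ b^(n/N - 1).
  refine ⟨D * b⁻¹, b ^ (1 / (N : ℝ)), by positivity, by positivity,
    Real.rpow_lt_one hb0.le hb1 (by positivity), fun n => ?_⟩
  rw [← Nat.div_add_mod n N]
  refine (hblock _ _ (Nat.mod_lt _ hN)).trans (ENNReal.ofReal_le_ofReal ?_)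
  rw [Nat.div_add_mod n N, mul_assoc]
  refine mul_le_mul_of_nonneg_left ?_ hD0
  rw [inv_mul_eq_div, le_div_iff₀ hb0, ← pow_succ, ← Real.rpow_natCast b, ← Real.rpow_natCast,
    ← Real.rpow_mul hb0.le]
  refine Real.rpow_le_rpow_of_exponent_ge hb0 hb1.le ?_
  have h1 : n < N * (n / N + 1) := by
    have := Nat.div_add_mod n N
    have := Nat.mod_lt n hN
    rw [mul_add]; omega
  have h2 : (n : ℝ) ≤ N * ((n / N + 1 : ℕ) : ℝ) := by exact_mod_cast h1.le
  rw [one_div, inv_mul_le_iff₀ hNr]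
  exact h2

namespace Param

variable {r s : ℕ}

/-- The `q`-th moment of the `n`-fold matrix product under i.i.d. innovations with law `μ`. -/
noncomputable def prodMoment (θ : Param r s) (μ : Measure ℝ) (q : ℝ)
    (n : ℕ) : ENNReal :=
  ∫⁻ y, ENNReal.ofReal (entrySum (θ.pastProd y n)) ^ q ∂(seqLaw μ)

variable (θ : Param r s) (μ : Measure ℝ) [IsProbabilityMeasure μ]

theorem measurable_ofReal_entrySum_rpow (q : ℝ) (n : ℕ) :
    Measurable fun y => ENNReal.ofReal (entrySum (θ.pastProd y n)) ^ q :=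
  (ENNReal.measurable_ofReal.comp (θ.measurable_entrySum_pastProd n)).pow_const q

/-- The product splits after m factors into two blocks driven by disjoint, hence independent, sets
of innovations. -/
theorem prodMoment_add_le {q : ℝ} (hq : 0 ≤ q) (m n : ℕ) :
    θ.prodMoment μ q (m + n) ≤ θ.prodMoment μ q m * θ.prodMoment μ q n := by
  unfold prodMoment
  rw [← lintegral_mul_comp_drop μ m (θ.measurable_ofReal_entrySum_rpow q m)
    (θ.measurable_ofReal_entrySum_rpow q n) fun y y' h => by rw [θ.pastProd_congr h]]
  refine lintegral_mono fun y => ?_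
  simp only
  rw [← ENNReal.mul_rpow_of_nonneg _ _ hq, ← ENNReal.ofReal_mul (entrySum_nonneg _), pastProd_add]
  exact ENNReal.rpow_le_rpow (ENNReal.ofReal_le_ofReal (entrySum_mul_le _ _)) hq

variable {μ}

theorem lintegral_one_add_sq (hμ : ∫⁻ z, ENNReal.ofReal (z ^ 2) ∂μ = 1) :
    ∫⁻ z, ENNReal.ofReal (1 + z ^ 2) ∂μ = 2 := by
  have : ∀ z : ℝ, ENNReal.ofReal (1 + z ^ 2) = 1 + ENNReal.ofReal (z ^ 2) := fun z => by
    rw [ENNReal.ofReal_add zero_le_one (sq_nonneg z), ENNReal.ofReal_one]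
  simp only [this]
  rw [lintegral_add_left measurable_const, hμ]
  simp [one_add_one_eq_two]

theorem rpow_le_self_of_one_le {x : ENNReal} (hx : 1 ≤ x) {q : ℝ} (hq : q ≤ 1) : x ^ q ≤ x := by
  conv_rhs => rw [← ENNReal.rpow_one x]
  exact ENNReal.rpow_le_rpow_of_exponent_le hx hq

/-- Since 1 + z² ≥ 1, powers q ≤ 1 only decrease it, so the second moment of the innovations
suffices uniformly in q. -/
theorem lintegral_one_add_sq_rpow_le (hμ : ∫⁻ z, ENNReal.ofReal (z ^ 2) ∂μ = 1) {q : ℝ}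
    (hq1 : q ≤ 1) : ∫⁻ z, ENNReal.ofReal (1 + z ^ 2) ^ q ∂μ ≤ 2 := by
  rw [← lintegral_one_add_sq hμ]
  refine lintegral_mono fun z => rpow_le_self_of_one_le ?_ hq1
  rw [← ENNReal.ofReal_one]
  exact ENNReal.ofReal_le_ofReal (by nlinarith [sq_nonneg z])

theorem prodMoment_ne_top (hμ : ∫⁻ z, ENNReal.ofReal (z ^ 2) ∂μ = 1) {q : ℝ} (hq : 0 ≤ q)
    (hq1 : q ≤ 1) (n : ℕ) : θ.prodMoment μ q n ≠ ⊤ := by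
  induction n with
  | zero =>
    unfold prodMoment
    simp only [pastProd]
    rw [lintegral_const]
    simp [ENNReal.rpow_eq_top_iff, hq]
  | succ n ih =>
    refine ne_top_of_le_ne_top (ENNReal.mul_ne_top ih ?_) (θ.prodMoment_add_le μ hq n 1)
    have hle : θ.prodMoment μ q 1 ≤ ENNReal.ofReal θ.matBound ^ q * 2 := by
      unfold prodMoment
      calc ∫⁻ y, ENNReal.ofReal (entrySum (θ.pastProd y 1)) ^ q ∂(seqLaw μ)
          ≤ ∫⁻ y, ENNReal.ofReal θ.matBound ^ q * ENNReal.ofReal (1 + y 0 ^ 2) ^ q ∂(seqLaw μ) := by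
            refine lintegral_mono fun y => ?_
            simp only
            rw [← ENNReal.mul_rpow_of_nonneg _ _ hq, ← ENNReal.ofReal_mul θ.matBound_nonneg]
            refine ENNReal.rpow_le_rpow (ENNReal.ofReal_le_ofReal ?_) hq
            simpa [pastProd] using θ.entrySum_matA_le (y 0)
        _ = ENNReal.ofReal θ.matBound ^ q * ∫⁻ z, ENNReal.ofReal (1 + z ^ 2) ^ q ∂μ := by
            rw [lintegral_const_mul _ (by fun_prop),
              lintegral_comp_eval μ 0 (g := fun z => ENNReal.ofReal (1 + z ^ 2) ^ q) (by fun_prop)]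
        _ ≤ _ := by gcongr; exact lintegral_one_add_sq_rpow_le hμ hq1
    exact ne_top_of_le_ne_top (ENNReal.mul_ne_top
      (ENNReal.rpow_ne_top_of_nonneg hq ENNReal.ofReal_ne_top) (by norm_num)) hle

/-- The geometric mean of the factors bounds the norm of the product, and the arithmetic mean
bounds the geometric mean. -/
theorem entrySum_pastProd_rpow_le (y : ℕ → ℝ) {n : ℕ} (hn : 0 < n) :
    entrySum (θ.pastProd y n) ^ (1 / (n : ℝ)) ≤
      (θ.matBound / n) * ∑ j ∈ Finset.range n, (1 + y j ^ 2) := by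
  have hnr : (0 : ℝ) < n := by exact_mod_cast hn
  calc entrySum (θ.pastProd y n) ^ (1 / (n : ℝ))
      ≤ (∏ j ∈ Finset.range n, entrySum (θ.matA (y j))) ^ (1 / (n : ℝ)) :=
        Real.rpow_le_rpow (entrySum_nonneg _) (θ.entrySum_pastProd_le y hn) (by positivity)
    _ = ∏ j ∈ Finset.range n, entrySum (θ.matA (y j)) ^ (1 / (n : ℝ)) :=
        (Real.finsetProd_rpow _ _ (fun _ _ => entrySum_nonneg _) _).symm
    _ ≤ ∑ j ∈ Finset.range n, (1 / (n : ℝ)) * entrySum (θ.matA (y j)) := by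
        refine Real.geom_mean_le_arith_mean_weighted _ _ _ (fun _ _ => by positivity) ?_
          fun _ _ => entrySum_nonneg _
        simp [hnr.ne']
    _ ≤ ∑ j ∈ Finset.range n, (1 / (n : ℝ)) * (θ.matBound * (1 + y j ^ 2)) :=
        Finset.sum_le_sum fun j _ =>
          mul_le_mul_of_nonneg_left (θ.entrySum_matA_le _) (by positivity)
    _ = _ := by rw [Finset.mul_sum]; refine Finset.sum_congr rfl fun j _ => ?_; ring

/-- If the norm of the product is geometrically small in probability, then some small moment of
some product is less than one. -/
theorem exists_prodMoment_lt_one (hμ : ∫⁻ z, ENNReal.ofReal (z ^ 2) ∂μ = 1) {ρ : ℝ} (hρ0 : 0 < ρ)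
    (hρ1 : ρ < 1)
    (hρ : Tendsto (fun n : ℕ => seqLaw μ {y | ρ ^ n ≤ entrySum (θ.pastProd y n)}) atTop (𝓝 0)) :
    ∃ q : ℝ, 0 < q ∧ q ≤ 1 ∧ ∃ n : ℕ, 0 < n ∧ θ.prodMoment μ q n < 1 := by
  -- The moment will be bounded by ρ^(1/2) + d/4 + d/4, which is less than ρ^(1/2) + d = 1.
  set d : ℝ := 1 - ρ ^ (1 / 2 : ℝ) with hd
  have hsq0 : 0 < ρ ^ (1 / 2 : ℝ) := by positivity
  have hd0 : 0 < d := sub_pos.2 (Real.rpow_lt_one hρ0.le hρ1 (by norm_num))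
  set K : ℝ := θ.matBound with hK
  have hK0 : 0 ≤ K := θ.matBound_nonneg
  -- The geometric mean of the factors has expectation at most 2K; this `t` makes 2K/t ≤ d/4.
  set t : ℝ := 8 * (K + 1) / d with ht
  have ht0 : 0 < t := by positivity
  have hsmall : (0 : ENNReal) < ENNReal.ofReal (d / (4 * t)) :=
    ENNReal.ofReal_pos.2 (by positivity)
  obtain ⟨n, hbad, hn⟩ := ((hρ.eventually_lt_const hsmall).and (eventually_gt_atTop 0)).exists
  have hnr : (0 : ℝ) < n := by exact_mod_cast hn
  have hn1 : (1 : ℝ) ≤ n := by exact_mod_cast hn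
  -- With u the n-th root of the norm, the moment is that of √u. Off the bad set u ≤ ρ; on it √u ≤ t
  -- + u/t, where t is weighted by a small probability and u/t has small expectation.
  refine ⟨1 / n * (1 / 2), by positivity, ?_, n, hn, ?_⟩
  · rw [one_div_mul_one_div, div_le_one (by positivity)]; linarith
  set bad : Set (ℕ → ℝ) := {y | ρ ^ n ≤ entrySum (θ.pastProd y n)} with hbaddef
  have hbadm : MeasurableSet bad :=
    measurableSet_le measurable_const (θ.measurable_entrySum_pastProd n)
  have hpt : ∀ y, ENNReal.ofReal (entrySum (θ.pastProd y n)) ^ (1 / (n : ℝ) * (1 / 2)) ≤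
      ENNReal.ofReal (ρ ^ (1 / 2 : ℝ)) + bad.indicator (fun _ => ENNReal.ofReal t) y
        + ENNReal.ofReal (K / n / t) * ∑ j ∈ Finset.range n, ENNReal.ofReal (1 + y j ^ 2) := by
    intro y
    set x := entrySum (θ.pastProd y n) with hx
    have hx0 : 0 ≤ x := entrySum_nonneg _
    set u := x ^ (1 / (n : ℝ)) with hu
    have hu0 : 0 ≤ u := Real.rpow_nonneg hx0 _
    have hule : u / t ≤ K / n / t * ∑ j ∈ Finset.range n, (1 + y j ^ 2) := by
      rw [div_mul_eq_mul_div]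
      exact div_le_div_of_nonneg_right (θ.entrySum_pastProd_rpow_le y hn) ht0.le
    have hut : ENNReal.ofReal (u / t) ≤
        ENNReal.ofReal (K / n / t) * ∑ j ∈ Finset.range n, ENNReal.ofReal (1 + y j ^ 2) := by
      rw [← ENNReal.ofReal_sum_of_nonneg fun j _ => by positivity,
        ← ENNReal.ofReal_mul (by positivity)]
      exact ENNReal.ofReal_le_ofReal hule
    rw [ENNReal.ofReal_rpow_of_nonneg hx0 (by positivity), Real.rpow_mul hx0]
    by_cases hy : y ∈ bad
    · rw [Set.indicator_of_mem hy]
      have hsq : u ^ (1 / 2 : ℝ) ≤ t + u / t := by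
        rw [← Real.sqrt_eq_rpow]
        have h1 := Real.sqrt_nonneg u
        have h2 := Real.sq_sqrt hu0
        have h3 : Real.sqrt u * t ≤ t * t + u := by nlinarith [sq_nonneg (Real.sqrt u - t)]
        have h4 : t + u / t = (t * t + u) / t := by field_simp
        rw [h4, le_div_iff₀ ht0]; exact h3
      calc ENNReal.ofReal (u ^ (1 / 2 : ℝ)) ≤ ENNReal.ofReal (t + u / t) :=
            ENNReal.ofReal_le_ofReal hsq
        _ = ENNReal.ofReal t + ENNReal.ofReal (u / t) :=
            ENNReal.ofReal_add ht0.le (by positivity)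
        _ ≤ _ := by gcongr; exact le_add_self
    · rw [Set.indicator_of_notMem hy, add_zero]
      refine le_trans (ENNReal.ofReal_le_ofReal ?_) le_self_add
      refine Real.rpow_le_rpow hu0 ?_ (by norm_num)
      have hlt : x ≤ ρ ^ n := (not_le.1 hy).le
      calc u ≤ (ρ ^ n) ^ (1 / (n : ℝ)) := Real.rpow_le_rpow hx0 hlt (by positivity)
        _ = ρ := by
          rw [← Real.rpow_natCast, ← Real.rpow_mul hρ0.le, mul_one_div_cancel hnr.ne',
            Real.rpow_one]
  have hint : ∫⁻ y, ENNReal.ofReal (K / n / t) *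
      ∑ j ∈ Finset.range n, ENNReal.ofReal (1 + y j ^ 2) ∂(seqLaw μ) ≤
        ENNReal.ofReal (d / 4) := by
    rw [lintegral_const_mul _ (by fun_prop), lintegral_finsetSum _ (by fun_prop)]
    have : ∀ j ∈ Finset.range n, ∫⁻ y, ENNReal.ofReal (1 + y j ^ 2) ∂(seqLaw μ) =
        ENNReal.ofReal 2 := fun j _ => by
      rw [lintegral_comp_eval μ j (g := fun z => ENNReal.ofReal (1 + z ^ 2)) (by fun_prop),
        lintegral_one_add_sq hμ]
      norm_num
    rw [Finset.sum_congr rfl this, Finset.sum_const, Finset.card_range, nsmul_eq_mul,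
      ← ENNReal.ofReal_natCast n, ← ENNReal.ofReal_mul hnr.le, ← ENNReal.ofReal_mul (by positivity)]
    refine ENNReal.ofReal_le_ofReal ?_
    have h1 : K / n / t * (n * 2) = 2 * K / t := by field_simp
    rw [h1, ht, div_div_eq_mul_div, div_le_iff₀ (by positivity)]
    nlinarith
  have hbadint : ENNReal.ofReal t * seqLaw μ bad ≤ ENNReal.ofReal (d / 4) := by
    calc ENNReal.ofReal t * seqLaw μ bad ≤ ENNReal.ofReal t * ENNReal.ofReal (d / (4 * t)) := by
          gcongr
      _ = ENNReal.ofReal (d / 4) := by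
          rw [← ENNReal.ofReal_mul ht0.le]; congr 1; field_simp
  unfold prodMoment
  calc ∫⁻ y, ENNReal.ofReal (entrySum (θ.pastProd y n)) ^ (1 / (n : ℝ) * (1 / 2)) ∂(seqLaw μ)
      ≤ ∫⁻ y, (ENNReal.ofReal (ρ ^ (1 / 2 : ℝ)) + bad.indicator (fun _ => ENNReal.ofReal t) y
        + ENNReal.ofReal (K / n / t) * ∑ j ∈ Finset.range n, ENNReal.ofReal (1 + y j ^ 2))
          ∂(seqLaw μ) := lintegral_mono hpt
    _ = ENNReal.ofReal (ρ ^ (1 / 2 : ℝ)) + ENNReal.ofReal t * seqLaw μ bad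
        + ∫⁻ y, ENNReal.ofReal (K / n / t) *
          ∑ j ∈ Finset.range n, ENNReal.ofReal (1 + y j ^ 2) ∂(seqLaw μ) := by
        rw [lintegral_add_right _ (by fun_prop), lintegral_add_left measurable_const,
          lintegral_indicator_const hbadm]
        simp
    _ ≤ ENNReal.ofReal (ρ ^ (1 / 2 : ℝ)) + ENNReal.ofReal (d / 4) + ENNReal.ofReal (d / 4) := by
        gcongr
    _ = ENNReal.ofReal (ρ ^ (1 / 2 : ℝ) + d / 4 + d / 4) := by
        rw [ENNReal.ofReal_add (by positivity) (by positivity),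
          ENNReal.ofReal_add (by positivity) (by positivity)]
    _ < 1 := by
        rw [← ENNReal.ofReal_one]
        exact (ENNReal.ofReal_lt_ofReal_iff one_pos).2 (by linarith)

/-- Some small moment of the matrix products decays geometrically. -/
theorem exists_prodMoment_le_geometric (hμ : ∫⁻ z, ENNReal.ofReal (z ^ 2) ∂μ = 1) {ρ : ℝ}
    (hρ0 : 0 < ρ) (hρ1 : ρ < 1)
    (hρ : Tendsto (fun n : ℕ => seqLaw μ {y | ρ ^ n ≤ entrySum (θ.pastProd y n)}) atTop (𝓝 0)) :
    ∃ q : ℝ, 0 < q ∧ q ≤ 1 ∧ ∃ C c : ℝ, 0 ≤ C ∧ 0 < c ∧ c < 1 ∧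
      ∀ n, θ.prodMoment μ q n ≤ ENNReal.ofReal (C * c ^ n) := by
  obtain ⟨q, hq0, hq1, n, hn, hlt⟩ := θ.exists_prodMoment_lt_one hμ hρ0 hρ1 hρ
  exact ⟨q, hq0, hq1, exists_geometric_bound (θ.prodMoment_add_le μ hq0.le)
    (θ.prodMoment_ne_top hμ hq0.le hq1) hn hlt⟩

end Param

end GarchModel

namespace GarchModel

/-- Subadditivity of x ↦ x^q on finite sums passes to the limit by continuity. -/
theorem ennreal_tsum_rpow_le {a : ℕ → ENNReal} {q : ℝ} (hq : 0 < q) (hq1 : q ≤ 1) :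
    (∑' n, a n) ^ q ≤ ∑' n, a n ^ q := by
  have h := ((ENNReal.continuous_rpow_const (y := q)).tendsto _).comp
    (ENNReal.summable (f := a)).hasSum
  refine le_of_tendsto' h fun t => ?_
  refine le_trans ?_ (ENNReal.sum_le_tsum t)
  exact Finset.le_sum_of_subadditive (fun x : ENNReal => x ^ q) (ENNReal.zero_rpow_of_pos hq).le
    (fun x y => ENNReal.rpow_add_le_add_rpow x y hq.le hq1) t a

namespace Param

variable {r s : ℕ}

/-! ### From the Lyapunov exponent to smallness in probability. -/

section Lyapunov

variable {Ω : Type*} [MeasurableSpace Ω] {P : Measure Ω} {ζ : ℤ → Ω → ℝ}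

/-- A negative Lyapunov exponent makes the norm of the products eventually smaller than a
geometric sequence. -/
theorem exists_ae_eventually_entrySum_lt {θ : Param r s} {g : EReal}
    (hg : HasTopLyapunovExponent P ζ θ g) (hg0 : g < 0) :
    ∃ ρ : ℝ, 0 < ρ ∧ ρ < 1 ∧ ∀ᵐ ω ∂P, ∀ᶠ n : ℕ in atTop,
      entrySum (θ.prodA (fun i => ζ i ω) n) < ρ ^ n := by
  obtain ⟨c, hgc, hc0⟩ := EReal.lt_iff_exists_real_btwn.1 hg0
  have hc : c < 0 := by exact_mod_cast hc0
  -- The spectral norm is eventually below e^(cn). One of its two factors e^(cn/2) absorbs the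
  -- dimension constant, the other is the claimed rate.
  refine ⟨Real.exp (c / 2), Real.exp_pos _, Real.exp_lt_one_iff.2 (by linarith), ?_⟩
  have hcard : ∀ᶠ n : ℕ in atTop,
      (Fintype.card (Fin r ⊕ Fin s) : ℝ) ^ 2 * Real.exp (c / 2) ^ n < 1 := by
    have h1 := (tendsto_pow_atTop_nhds_zero_of_lt_one (Real.exp_pos (c / 2)).le
      (Real.exp_lt_one_iff.2 (by linarith : c / 2 < 0))).const_mul
        ((Fintype.card (Fin r ⊕ Fin s) : ℝ) ^ 2)
    rw [mul_zero] at h1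
    exact h1.eventually_lt_const one_pos
  filter_upwards [hg] with ω hω
  filter_upwards [hω.eventually_lt_const hgc, hcard, eventually_gt_atTop 0] with n hn hcn hn0
  have hnr : (0 : ℝ) < n := by exact_mod_cast hn0
  set M := matSpectralNorm (θ.prodA (fun i => ζ i ω) n) with hM
  have hM1 : M < Real.exp (c / 2) ^ n * Real.exp (c / 2) ^ n := by
    by_contra hcon
    rw [not_lt, ← mul_pow, ← Real.exp_add, add_halves, ← Real.exp_nat_mul] at hcon
    have hMpos : 0 < M := lt_of_lt_of_le (Real.exp_pos _) hcon
    rw [ENNReal.log_ofReal_of_pos hMpos, ← EReal.coe_mul, EReal.coe_lt_coe_iff] at hn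
    have h2 : n * c ≤ Real.log M := (Real.le_log_iff_exp_le hMpos).2 hcon
    rw [inv_mul_lt_iff₀ hnr] at hn
    linarith
  have hpos : 0 < Real.exp (c / 2) ^ n := by positivity
  refine (entrySum_le_matSpectralNorm _).trans_lt ?_
  rw [← hM]
  -- The first case is r = s = 0, where the matrices are empty.
  rcases (sq_nonneg (Fintype.card (Fin r ⊕ Fin s) : ℝ)).eq_or_lt with h0 | h0
  · rw [← h0, zero_mul]; exact hpos
  · calc (Fintype.card (Fin r ⊕ Fin s) : ℝ) ^ 2 * M
        < (Fintype.card (Fin r ⊕ Fin s) : ℝ) ^ 2 *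
          (Real.exp (c / 2) ^ n * Real.exp (c / 2) ^ n) := mul_lt_mul_of_pos_left hM1 h0
      _ = ((Fintype.card (Fin r ⊕ Fin s) : ℝ) ^ 2 * Real.exp (c / 2) ^ n) *
          Real.exp (c / 2) ^ n := by ring
      _ < 1 * Real.exp (c / 2) ^ n := mul_lt_mul_of_pos_right hcn hpos
      _ = _ := one_mul _

/-- For each n separately, the forward product has the law of the product along an i.i.d. past.
Hence almost sure smallness transfers only as smallness in probability. -/
theorem exists_tendsto_seqLaw_entrySum [IsProbabilityMeasure P]
    {θ : Param r s} (hζ : IsInnovation P ζ) {g : EReal}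
    (hg : HasTopLyapunovExponent P ζ θ g) (hg0 : g < 0) :
    ∃ ρ : ℝ, 0 < ρ ∧ ρ < 1 ∧
      Tendsto (fun n : ℕ => seqLaw (P.map (ζ 0)) {y | ρ ^ n ≤ entrySum (θ.pastProd y n)})
        atTop (𝓝 0) := by
  obtain ⟨ρ, hρ0, hρ1, hρ⟩ := exists_ae_eventually_entrySum_lt hg hg0
  refine ⟨ρ, hρ0, hρ1, ?_⟩
  have hms : ∀ n : ℕ, MeasurableSet {y : ℕ → ℝ | ρ ^ n ≤ entrySum (θ.pastProd y n)} := fun n =>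
    measurableSet_le measurable_const (θ.measurable_entrySum_pastProd n)
  have heq : ∀ n : ℕ, seqLaw (P.map (ζ 0)) {y | ρ ^ n ≤ entrySum (θ.pastProd y n)} =
      P {ω | ρ ^ n ≤ entrySum (θ.prodA (fun i => ζ i ω) n)} := fun n => by
    rw [← hζ.map_past n, Measure.map_apply (hζ.measurable_past_path n) (hms n)]
    simp only [prodA_eq_pastProd]
    rfl
  simp only [heq]
  rw [← measure_empty (μ := P)]
  refine tendsto_measure_of_ae_tendsto_indicator_of_isFiniteMeasure atTop MeasurableSet.empty
    (fun n => ?_) ?_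
  · simp only [prodA_eq_pastProd]
    exact (hζ.measurable_past_path n) (hms n)
  · filter_upwards [hρ] with ω hω
    filter_upwards [hω] with n hn
    simpa using hn

end Lyapunov

/-! ### The series solution and its moments. -/

/-- All coefficients are nonnegative. -/
structure IsNonneg (θ : Param r s) : Prop where
  a0 : 0 ≤ θ.a0
  α : ∀ j, 0 ≤ θ.α j
  β : ∀ k, 0 ≤ θ.β k

namespace IsNonneg

variable {θ : Param r s}

theorem f_nonneg (h : θ.IsNonneg) (i : Fin r ⊕ Fin s) : 0 ≤ θ.f i := by
  rcases i with i | i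
  · exact h.α i
  · exact h.β i

theorem matA_nonneg (h : θ.IsNonneg) (z : ℝ) (i j : Fin r ⊕ Fin s) : 0 ≤ θ.matA z i j := by
  rcases i with i | i
  · simp only [matA]
    split_ifs
    · exact mul_nonneg (sq_nonneg z) (h.f_nonneg j)
    · rcases j with j | j
      · simp only [Sum.elim_inl]; split_ifs <;> norm_num
      · simp
  · simp only [matA]
    split_ifs
    · exact h.f_nonneg j
    · rcases j with j | j
      · simp
      · simp only [Sum.elim_inr]; split_ifs <;> norm_num

theorem shock_nonneg (h : θ.IsNonneg) (z : ℝ) (i : Fin r ⊕ Fin s) : 0 ≤ θ.shock z i := by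
  rcases i with i | i
  · simp only [shock, Sum.elim_inl]
    split_ifs
    · exact mul_nonneg (sq_nonneg z) h.a0
    · exact le_rfl
  · simp only [shock, Sum.elim_inr]
    split_ifs
    · exact h.a0
    · exact le_rfl

theorem pastProd_nonneg (h : θ.IsNonneg) (y : ℕ → ℝ) (n : ℕ) (i j : Fin r ⊕ Fin s) :
    0 ≤ θ.pastProd y n i j := by
  induction n generalizing y i with
  | zero =>
    simp only [pastProd, Matrix.one_apply]
    split_ifs <;> norm_num
  | succ n ih =>
    rw [pastProd_succ, Matrix.mul_apply]
    exact Finset.sum_nonneg fun k _ => mul_nonneg (h.matA_nonneg _ _ _) (ih _ _)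

theorem pastProd_mulVec_shock_nonneg (h : θ.IsNonneg) (y : ℕ → ℝ) (n : ℕ) (z : ℝ)
    (i : Fin r ⊕ Fin s) : 0 ≤ (θ.pastProd y n).mulVec (θ.shock z) i := by
  rw [Matrix.mulVec, dotProduct]
  exact Finset.sum_nonneg fun j _ => mul_nonneg (h.pastProd_nonneg y n i j) (h.shock_nonneg z j)

end IsNonneg

variable (θ : Param r s)

/-- The series `∑ₙ A(y₀) ⋯ A(y_{n-1}) b(y_n)` in `[0, ∞]`. -/
noncomputable def stateSum (y : ℕ → ℝ) (i : Fin r ⊕ Fin s) : ENNReal :=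
  ∑' n, ENNReal.ofReal ((θ.pastProd y n).mulVec (θ.shock (y n)) i)

/-- The series of norms dominating `stateSum`. -/
noncomputable def stateBound (y : ℕ → ℝ) : ENNReal :=
  ∑' n, ENNReal.ofReal (entrySum (θ.pastProd y n)) * ENNReal.ofReal (|θ.a0| * (1 + y n ^ 2))

/-- The state vector determined by the past innovations `y`. -/
noncomputable def state (y : ℕ → ℝ) (i : Fin r ⊕ Fin s) : ℝ := (θ.stateSum y i).toReal

/-- The volatility as a function of the innovations up to the previous time. -/
noncomputable def volFun (y : ℕ → ℝ) : ℝ := θ.a0 + θ.f ⬝ᵥ θ.state y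

/-- The squared observation as a function of the innovations up to the present time. -/
noncomputable def obsFun (y : ℕ → ℝ) : ℝ := y 0 ^ 2 * θ.volFun (drop 1 y)

theorem measurable_stateSum (i : Fin r ⊕ Fin s) : Measurable fun y => θ.stateSum y i := by
  refine Measurable.tsum fun n => ENNReal.measurable_ofReal.comp ?_
  simp only [Matrix.mulVec, dotProduct]
  exact Finset.measurable_sum _ fun j _ => (θ.measurable_pastProd n i j).mul
    ((θ.measurable_shock j).comp (measurable_pi_apply n))

theorem measurable_stateBound : Measurable θ.stateBound :=
  Measurable.tsum fun n =>
    (ENNReal.measurable_ofReal.comp (θ.measurable_entrySum_pastProd n)).mul (by fun_prop)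

theorem measurable_volFun : Measurable θ.volFun := by
  unfold volFun
  simp only [dotProduct]
  exact measurable_const.add (Finset.measurable_sum _ fun j _ =>
    ((θ.measurable_stateSum j).ennreal_toReal).const_mul _)

theorem measurable_obsFun : Measurable θ.obsFun :=
  ((measurable_pi_apply 0).pow_const 2).mul (θ.measurable_volFun.comp (measurable_drop 1))

theorem stateSum_le_stateBound (y : ℕ → ℝ) (i : Fin r ⊕ Fin s) :
    θ.stateSum y i ≤ θ.stateBound y := by
  refine ENNReal.tsum_le_tsum fun n => ?_
  rw [← ENNReal.ofReal_mul (entrySum_nonneg _)]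
  refine ENNReal.ofReal_le_ofReal ((le_abs_self _).trans ((abs_mulVec_le _ _ _).trans ?_))
  exact mul_le_mul_of_nonneg_left (θ.norm_shock_le _) (entrySum_nonneg _)

theorem stateBound_le (y : ℕ → ℝ) :
    θ.stateBound y ≤ ENNReal.ofReal (entrySum (θ.pastProd y 0)) *
      ENNReal.ofReal (|θ.a0| * (1 + y 0 ^ 2)) +
      ENNReal.ofReal (entrySum (θ.matA (y 0))) * θ.stateBound (drop 1 y) := by
  unfold stateBound
  rw [tsum_eq_zero_add' ENNReal.summable, ← ENNReal.tsum_mul_left]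
  refine add_le_add le_rfl (ENNReal.tsum_le_tsum fun n => ?_)
  rw [← mul_assoc, ← ENNReal.ofReal_mul (entrySum_nonneg (θ.matA (y 0)))]
  have : drop 1 y n = y (n + 1) := by simp [drop, Nat.add_comm]
  rw [this]
  exact mul_le_mul' (ENNReal.ofReal_le_ofReal
    (entrySum_mul_le (θ.matA (y 0)) (θ.pastProd (drop 1 y) n))) le_rfl

/-- Finiteness depends only on the remote past, so it survives the replacement of an innovation. -/
theorem stateBound_lt_top_of_drop_one {y : ℕ → ℝ} (h : θ.stateBound (drop 1 y) < ⊤) :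
    θ.stateBound y < ⊤ :=
  (θ.stateBound_le y).trans_lt (ENNReal.add_lt_top.2
    ⟨ENNReal.mul_lt_top ENNReal.ofReal_lt_top ENNReal.ofReal_lt_top,
      ENNReal.mul_lt_top ENNReal.ofReal_lt_top h⟩)

theorem norm_state_le {y : ℕ → ℝ} (h : θ.stateBound y < ⊤) :
    ‖θ.state y‖ ≤ (θ.stateBound y).toReal := by
  refine (pi_norm_le_iff_of_nonneg ENNReal.toReal_nonneg).2 fun i => ?_
  rw [Real.norm_eq_abs, state, abs_of_nonneg ENNReal.toReal_nonneg]
  exact ENNReal.toReal_mono h.ne (θ.stateSum_le_stateBound y i)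

variable {θ}

/-- Nonnegativity makes `ENNReal.ofReal` additive and multiplicative on all terms, so the recursion
holds in [0, ∞] before convergence is known. -/
theorem stateSum_eq (hθ : θ.IsNonneg) (y : ℕ → ℝ) (i : Fin r ⊕ Fin s) :
    θ.stateSum y i = ENNReal.ofReal (θ.shock (y 0) i) +
      ∑ j, ENNReal.ofReal (θ.matA (y 0) i j) * θ.stateSum (drop 1 y) j := by
  unfold stateSum
  rw [tsum_eq_zero_add' ENNReal.summable]
  congr 1
  · simp [pastProd]
  · simp only [← ENNReal.tsum_mul_left]
    rw [← Summable.tsum_finsetSum fun _ _ => ENNReal.summable]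
    refine tsum_congr fun n => ?_
    have : drop 1 y n = y (n + 1) := by simp [drop, Nat.add_comm]
    rw [pastProd_succ, ← Matrix.mulVec_mulVec, Matrix.mulVec, dotProduct,
      ENNReal.ofReal_sum_of_nonneg fun j _ => mul_nonneg (hθ.matA_nonneg _ _ _)
        (hθ.pastProd_mulVec_shock_nonneg _ _ _ _), this]
    exact Finset.sum_congr rfl fun j _ => ENNReal.ofReal_mul (hθ.matA_nonneg _ _ _)

/-- Finiteness is needed here because `toReal` sends ∞ to 0. -/
theorem state_eq (hθ : θ.IsNonneg) {y : ℕ → ℝ} (h : θ.stateBound (drop 1 y) < ⊤) :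
    θ.state y = θ.shock (y 0) + (θ.matA (y 0)).mulVec (θ.state (drop 1 y)) := by
  have hfin : ∀ j, θ.stateSum (drop 1 y) j ≠ ⊤ := fun j =>
    ((θ.stateSum_le_stateBound _ j).trans_lt h).ne
  funext i
  have hne : ∀ j ∈ Finset.univ,
      ENNReal.ofReal (θ.matA (y 0) i j) * θ.stateSum (drop 1 y) j ≠ ⊤ := fun j _ =>
    ENNReal.mul_ne_top ENNReal.ofReal_ne_top (hfin j)
  rw [state, stateSum_eq hθ, ENNReal.toReal_add ENNReal.ofReal_ne_top
    (ENNReal.sum_ne_top.2 hne), ENNReal.toReal_ofReal (hθ.shock_nonneg _ _),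
    ENNReal.toReal_sum hne, Pi.add_apply, Matrix.mulVec, dotProduct]
  congr 1
  refine Finset.sum_congr rfl fun j _ => ?_
  rw [ENNReal.toReal_mul, ENNReal.toReal_ofReal (hθ.matA_nonneg _ _ _), state]

theorem volFun_nonneg (hθ : θ.IsNonneg) (y : ℕ → ℝ) : 0 ≤ θ.volFun y :=
  add_nonneg hθ.a0 (Finset.sum_nonneg fun j _ =>
    mul_nonneg (hθ.f_nonneg j) ENNReal.toReal_nonneg)

section Moments

variable {μ : Measure ℝ}

/-- The q-th power is taken termwise by subadditivity. The n-th product is independent of `y n`, so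
the n-th term is at most a constant times c^n. -/
theorem lintegral_stateBound_rpow_lt_top [IsProbabilityMeasure μ]
     (hμ : ∫⁻ z, ENNReal.ofReal (z ^ 2) ∂μ = 1) {q : ℝ}
    (hq : 0 < q) (hq1 : q ≤ 1) {C c : ℝ} (hC : 0 ≤ C) (hc0 : 0 < c) (hc1 : c < 1)
    (hmom : ∀ n, θ.prodMoment μ q n ≤ ENNReal.ofReal (C * c ^ n)) :
    ∫⁻ y, θ.stateBound y ^ q ∂(seqLaw μ) < ⊤ := by
  have hterm : ∀ n, ∫⁻ y, (ENNReal.ofReal (entrySum (θ.pastProd y n)) *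
      ENNReal.ofReal (|θ.a0| * (1 + y n ^ 2))) ^ q ∂(seqLaw μ) ≤
        ENNReal.ofReal (C * c ^ n) * (ENNReal.ofReal |θ.a0| ^ q * 2) := by
    intro n
    have hG : Measurable fun y : ℕ → ℝ => ENNReal.ofReal (|θ.a0| * (1 + y 0 ^ 2)) ^ q := by
      fun_prop
    calc ∫⁻ y, (ENNReal.ofReal (entrySum (θ.pastProd y n)) *
          ENNReal.ofReal (|θ.a0| * (1 + y n ^ 2))) ^ q ∂(seqLaw μ)
        = ∫⁻ y, ENNReal.ofReal (entrySum (θ.pastProd y n)) ^ q *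
          (fun y : ℕ → ℝ => ENNReal.ofReal (|θ.a0| * (1 + y 0 ^ 2)) ^ q) (drop n y)
            ∂(seqLaw μ) := by
          refine lintegral_congr fun y => ?_
          rw [ENNReal.mul_rpow_of_nonneg _ _ hq.le]
          simp [drop]
      _ = θ.prodMoment μ q n *
          ∫⁻ y, ENNReal.ofReal (|θ.a0| * (1 + y 0 ^ 2)) ^ q ∂(seqLaw μ) :=
          lintegral_mul_comp_drop μ n (θ.measurable_ofReal_entrySum_rpow q n) hG
            fun y y' h => by rw [θ.pastProd_congr h]
      _ ≤ _ := by
          refine mul_le_mul' (hmom n) ?_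
          simp only [ENNReal.ofReal_mul (abs_nonneg θ.a0), ENNReal.mul_rpow_of_nonneg _ _ hq.le]
          rw [lintegral_const_mul _ (by fun_prop),
            lintegral_comp_eval μ 0 (g := fun z => ENNReal.ofReal (1 + z ^ 2) ^ q) (by fun_prop)]
          gcongr
          exact lintegral_one_add_sq_rpow_le hμ hq1
  have hms : ∀ n : ℕ, Measurable fun y : ℕ → ℝ => (ENNReal.ofReal (entrySum (θ.pastProd y n)) *
      ENNReal.ofReal (|θ.a0| * (1 + y n ^ 2))) ^ q := fun n =>
    ((ENNReal.measurable_ofReal.comp (θ.measurable_entrySum_pastProd n)).mul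
      (by fun_prop)).pow_const q
  calc ∫⁻ y, θ.stateBound y ^ q ∂(seqLaw μ)
      ≤ ∫⁻ y, ∑' n, (ENNReal.ofReal (entrySum (θ.pastProd y n)) *
          ENNReal.ofReal (|θ.a0| * (1 + y n ^ 2))) ^ q ∂(seqLaw μ) :=
        lintegral_mono fun y => ennreal_tsum_rpow_le hq hq1
    _ = ∑' n, ∫⁻ y, (ENNReal.ofReal (entrySum (θ.pastProd y n)) *
          ENNReal.ofReal (|θ.a0| * (1 + y n ^ 2))) ^ q ∂(seqLaw μ) :=
        lintegral_tsum fun n => (hms n).aemeasurable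
    _ ≤ ∑' n, ENNReal.ofReal (C * c ^ n) * (ENNReal.ofReal |θ.a0| ^ q * 2) :=
        ENNReal.tsum_le_tsum hterm
    _ < ⊤ := by
        rw [ENNReal.tsum_mul_right]
        refine ENNReal.mul_lt_top ?_ (ENNReal.mul_lt_top
          (ENNReal.rpow_lt_top_of_nonneg hq.le ENNReal.ofReal_ne_top) (by norm_num))
        rw [← ENNReal.ofReal_tsum_of_nonneg (fun n => by positivity)
          ((summable_geometric_of_lt_one hc0.le hc1).mul_left C)]
        exact ENNReal.ofReal_lt_top

theorem ae_stateBound_lt_top {q : ℝ} (hq : 0 < q)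
    (h : ∫⁻ y, θ.stateBound y ^ q ∂(seqLaw μ) < ⊤) :
    ∀ᵐ y ∂(seqLaw μ), θ.stateBound y < ⊤ := by
  filter_upwards [ae_lt_top (θ.measurable_stateBound.pow_const q) h.ne] with y hy
  by_contra hcon
  rw [not_lt, top_le_iff] at hcon
  rw [hcon, ENNReal.top_rpow_of_pos hq] at hy
  exact lt_irrefl _ hy

end Moments

end Param

end GarchModel

/-! ### The state space form of the recursion. -/

namespace GarchModel

namespace Param

variable {r s : ℕ}

section Recursion

variable (θ : Param r s)

theorem dotProduct_f (v : Fin r ⊕ Fin s → ℝ) :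
    θ.f ⬝ᵥ v = ∑ j, θ.α j * v (Sum.inl j) + ∑ k, θ.β k * v (Sum.inr k) := by
  rw [dotProduct, Fintype.sum_sum_type]; rfl

theorem matA_mulVec_inl_zero (z : ℝ) (v : Fin r ⊕ Fin s → ℝ) {i : Fin r} (hi : (i : ℕ) = 0) :
    (θ.matA z).mulVec v (Sum.inl i) = z ^ 2 * (θ.f ⬝ᵥ v) := by
  simp only [Matrix.mulVec, dotProduct, matA, if_pos hi, Finset.mul_sum, mul_assoc]

theorem matA_mulVec_inr_zero (z : ℝ) (v : Fin r ⊕ Fin s → ℝ) {i : Fin s} (hi : (i : ℕ) = 0) :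
    (θ.matA z).mulVec v (Sum.inr i) = θ.f ⬝ᵥ v := by
  simp only [Matrix.mulVec, dotProduct, matA, if_pos hi]

theorem matA_mulVec_inl_succ (z : ℝ) (v : Fin r ⊕ Fin s → ℝ) {i j : Fin r}
    (hij : (i : ℕ) = (j : ℕ) + 1) : (θ.matA z).mulVec v (Sum.inl i) = v (Sum.inl j) := by
  have hi : (i : ℕ) ≠ 0 := by omega
  simp only [Matrix.mulVec, dotProduct, matA, if_neg hi, Fintype.sum_sum_type, Sum.elim_inl,
    Sum.elim_inr, zero_mul, Finset.sum_const_zero, add_zero, ite_mul, one_mul]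
  rw [Finset.sum_eq_single j (fun k _ hk => if_neg fun h => hk (Fin.ext (by omega)))
    (fun h => absurd (Finset.mem_univ j) h), if_pos hij]

theorem matA_mulVec_inr_succ (z : ℝ) (v : Fin r ⊕ Fin s → ℝ) {i j : Fin s}
    (hij : (i : ℕ) = (j : ℕ) + 1) : (θ.matA z).mulVec v (Sum.inr i) = v (Sum.inr j) := by
  have hi : (i : ℕ) ≠ 0 := by omega
  simp only [Matrix.mulVec, dotProduct, matA, if_neg hi, Fintype.sum_sum_type, Sum.elim_inl,
    Sum.elim_inr, zero_mul, Finset.sum_const_zero, zero_add, ite_mul, one_mul]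
  rw [Finset.sum_eq_single j (fun k _ hk => if_neg fun h => hk (Fin.ext (by omega)))
    (fun h => absurd (Finset.mem_univ j) h), if_pos hij]

/-- The real sequences `X` and `σ` solve the recursion along the innovation path `x`. -/
structure IsPathSolution (x X σ : ℤ → ℝ) : Prop where
  observation : ∀ i, X i = x i ^ 2 * σ i
  volatility : ∀ i, σ i = θ.a0 + ∑ j : Fin r, θ.α j * X (i - ((j : ℕ) + 1))
    + ∑ k : Fin s, θ.β k * σ (i - ((k : ℕ) + 1))

end Recursion

/-- The state vector `(X_i, …, X_{i-r+1}, σ_i, …, σ_{i-s+1})`. -/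
def stateOf (r s : ℕ) (X σ : ℤ → ℝ) (i : ℤ) : Fin r ⊕ Fin s → ℝ :=
  Sum.elim (fun j => X (i - (j : ℕ))) (fun k => σ (i - (k : ℕ)))

variable {θ : Param r s}

namespace IsPathSolution

variable {x X σ : ℤ → ℝ}

theorem volatility_eq (h : θ.IsPathSolution x X σ) (i : ℤ) :
    σ i = θ.a0 + θ.f ⬝ᵥ stateOf r s X σ (i - 1) := by
  rw [dotProduct_f, h.volatility i, add_assoc]
  simp only [stateOf, Sum.elim_inl, Sum.elim_inr, sub_sub, add_comm]

/-- The top row of each block is the recursion itself; the remaining rows shift the lags. -/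
theorem stateOf_eq (h : θ.IsPathSolution x X σ) (i : ℤ) :
    stateOf r s X σ i = θ.shock (x i) + (θ.matA (x i)).mulVec (stateOf r s X σ (i - 1)) := by
  funext b
  rw [Pi.add_apply]
  rcases b with j | k
  · by_cases hj : (j : ℕ) = 0
    · rw [θ.matA_mulVec_inl_zero _ _ hj]
      simp only [shock, Sum.elim_inl, if_pos hj]
      rw [← mul_add, ← h.volatility_eq i, ← h.observation i]
      simp [stateOf, hj]
    · have hlt := j.isLt
      rw [θ.matA_mulVec_inl_succ _ _ (i := j) (j := ⟨j - 1, by omega⟩)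
        (by simp only; omega)]
      simp only [shock, stateOf, Sum.elim_inl, if_neg hj, zero_add]
      congr 1
      push_cast [Nat.one_le_iff_ne_zero.2 hj]
      ring
  · by_cases hk : (k : ℕ) = 0
    · rw [θ.matA_mulVec_inr_zero _ _ hk]
      simp only [shock, Sum.elim_inr, if_pos hk]
      rw [← h.volatility_eq i]
      simp [stateOf, hk]
    · have hlt := k.isLt
      rw [θ.matA_mulVec_inr_succ _ _ (i := k) (j := ⟨k - 1, by omega⟩)
        (by simp only; omega)]
      simp only [shock, stateOf, Sum.elim_inr, if_neg hk, zero_add]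
      congr 1
      push_cast [Nat.one_le_iff_ne_zero.2 hk]
      ring

/-- The difference of two solutions is propagated by the matrix products. -/
theorem stateOf_sub_eq {X' σ' : ℤ → ℝ} (h : θ.IsPathSolution x X σ)
    (h' : θ.IsPathSolution x X' σ') (n : ℕ) (i : ℤ) :
    stateOf r s X σ i - stateOf r s X' σ' i =
      (θ.pastProd (past x i) n).mulVec (stateOf r s X σ (i - n) - stateOf r s X' σ' (i - n)) := by
  induction n generalizing i with
  | zero => simp [pastProd]
  | succ n ih =>
    rw [h.stateOf_eq i, h'.stateOf_eq i, add_sub_add_left_eq_sub, ← Matrix.mulVec_sub, ih,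
      pastProd_succ, past_zero, drop_past, Matrix.mulVec_mulVec]
    push_cast
    rw [sub_sub, add_comm (1 : ℤ)]

end IsPathSolution

/-- The state determined by the past consists of the present and past values of the causal
solution. -/
theorem state_past_eq (hθ : θ.IsNonneg) {x : ℤ → ℝ}
    (hx : ∀ i, θ.stateBound (past x i) < ⊤) (i : ℤ) :
    θ.state (past x i) = stateOf r s (fun i => θ.obsFun (past x i))
      (fun i => θ.volFun (past x (i - 1))) i := by
  have hrec : ∀ i, θ.state (past x i) = θ.shock (x i) +
      (θ.matA (x i)).mulVec (θ.state (past x (i - 1))) := fun i => by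
    have hd : drop 1 (past x i) = past x (i - 1) := by rw [drop_past]; norm_num
    have := state_eq hθ (y := past x i) (by rw [hd]; exact hx _)
    rwa [past_zero, hd] at this
  -- The shift rows move entry n + 1 at time i to entry n at time i - 1, so only the top entry needs
  -- the recursion.
  have hobs : ∀ (n : ℕ) (hn : n < r) (i : ℤ),
      θ.state (past x i) (Sum.inl ⟨n, hn⟩) = θ.obsFun (past x (i - n)) := by
    intro n
    induction n with
    | zero =>
      intro hn i
      rw [hrec i, Pi.add_apply, θ.matA_mulVec_inl_zero _ _ rfl]
      simp only [shock, Sum.elim_inl, if_true, Nat.cast_zero, sub_zero]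
      rw [← mul_add, obsFun, past_zero, drop_past, volFun]
      norm_num
    | succ n ih =>
      intro hn i
      rw [hrec i, Pi.add_apply, θ.matA_mulVec_inl_succ _ _ (j := ⟨n, by omega⟩) rfl, ih]
      simp only [shock, Sum.elim_inl, Nat.succ_ne_zero, if_false, zero_add]
      congr 2
      push_cast
      ring
  have hvol : ∀ (n : ℕ) (hn : n < s) (i : ℤ),
      θ.state (past x i) (Sum.inr ⟨n, hn⟩) = θ.volFun (past x (i - n - 1)) := by
    intro n
    induction n with
    | zero =>
      intro hn i
      rw [hrec i, Pi.add_apply, θ.matA_mulVec_inr_zero _ _ rfl]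
      simp only [shock, Sum.elim_inr, if_true, Nat.cast_zero, sub_zero]
      rfl
    | succ n ih =>
      intro hn i
      rw [hrec i, Pi.add_apply, θ.matA_mulVec_inr_succ _ _ (j := ⟨n, by omega⟩) rfl, ih]
      simp only [shock, Sum.elim_inr, Nat.succ_ne_zero, if_false, zero_add]
      congr 2
      push_cast
      ring
  funext b
  rcases b with j | k
  · exact hobs j j.isLt i
  · exact hvol k k.isLt i

theorem isPathSolution_causal (hθ : θ.IsNonneg) {x : ℤ → ℝ}
    (hx : ∀ i, θ.stateBound (past x i) < ⊤) :
    θ.IsPathSolution x (fun i => θ.obsFun (past x i)) (fun i => θ.volFun (past x (i - 1))) where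
  observation i := by
    rw [obsFun, past_zero, drop_past, Nat.cast_one]
  volatility i := by
    rw [volFun, state_past_eq hθ hx, dotProduct_f, add_assoc]
    simp only [stateOf, Sum.elim_inl, Sum.elim_inr, sub_sub, add_comm]

/-! ### Pathwise effect of replacing one innovation. -/

section Dependence

theorem stateBound_lt_top_of_drop {m : ℕ} {y : ℕ → ℝ} (h : θ.stateBound (drop m y) < ⊤) :
    θ.stateBound y < ⊤ := by
  induction m generalizing y with
  | zero =>
    have : drop 0 y = y := by funext j; simp [drop]
    rwa [this] at h
  | succ m ih =>
    refine θ.stateBound_lt_top_of_drop_one (ih ?_)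
    rwa [drop_drop, Nat.add_comm]

/-- Shared innovations give equal shocks, which cancel at each of the m steps. -/
theorem state_sub_state (hθ : θ.IsNonneg) {m : ℕ} {u u' : ℕ → ℝ} (heq : ∀ j < m, u j = u' j)
    (hu : θ.stateBound (drop m u) < ⊤) (hu' : θ.stateBound (drop m u') < ⊤) :
    θ.state u - θ.state u' =
      (θ.pastProd u m).mulVec (θ.state (drop m u) - θ.state (drop m u')) := by
  induction m generalizing u u' with
  | zero =>
    have h0 : ∀ y, drop 0 y = y := fun y => by funext j; simp [drop]
    simp [pastProd, h0]
  | succ m ih =>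
    have hd : ∀ y, drop (m + 1) y = drop m (drop 1 y) := fun y => by
      rw [drop_drop, Nat.add_comm]
    rw [hd] at hu hu'
    rw [state_eq hθ (stateBound_lt_top_of_drop hu), state_eq hθ (stateBound_lt_top_of_drop hu'),
      ← heq 0 (by omega), add_sub_add_left_eq_sub, ← Matrix.mulVec_sub,
      ih (u := drop 1 u) (u' := drop 1 u') (fun j hj => heq (1 + j) (by omega)) hu hu',
      pastProd_succ, Matrix.mulVec_mulVec, hd, hd]

/-- Isolates `y 0`: when it is replaced, the factor from the older past stays the same. -/
theorem norm_state_le_of_drop (hθ : θ.IsNonneg) {y : ℕ → ℝ} (h : θ.stateBound (drop 1 y) < ⊤) :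
    ‖θ.state y‖ ≤ (|θ.a0| + θ.matBound) * (1 + y 0 ^ 2) *
      (1 + (θ.stateBound (drop 1 y)).toReal) := by
  set S := (θ.stateBound (drop 1 y)).toReal with hS
  have hS0 : 0 ≤ S := ENNReal.toReal_nonneg
  have hw : 0 ≤ 1 + y 0 ^ 2 := by positivity
  have hK := θ.matBound_nonneg
  have ha := abs_nonneg θ.a0
  rw [state_eq hθ h]
  calc ‖θ.shock (y 0) + (θ.matA (y 0)).mulVec (θ.state (drop 1 y))‖
      ≤ |θ.a0| * (1 + y 0 ^ 2) + θ.matBound * (1 + y 0 ^ 2) * S := by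
        refine (norm_add_le _ _).trans (add_le_add (θ.norm_shock_le _) ?_)
        refine (norm_mulVec_le _ _).trans ?_
        exact mul_le_mul (θ.entrySum_matA_le _) (θ.norm_state_le h) (norm_nonneg _)
          (by positivity)
    _ ≤ _ := by
        have h1 : 0 ≤ |θ.a0| * (1 + y 0 ^ 2) * S := by positivity
        have h2 : 0 ≤ θ.matBound * (1 + y 0 ^ 2) := by positivity
        nlinarith

theorem abs_f_dotProduct_le (v : Fin r ⊕ Fin s → ℝ) : |θ.f ⬝ᵥ v| ≤ (∑ i, |θ.f i|) * ‖v‖ := by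
  rw [dotProduct, Finset.sum_mul]
  refine (Finset.abs_sum_le_sum_abs _ _).trans (Finset.sum_le_sum fun j _ => ?_)
  rw [abs_mul]
  exact mul_le_mul_of_nonneg_left (norm_le_pi_norm v j) (abs_nonneg _)

/-- A constant in the bounds on `obsFun` and its increments. -/
noncomputable def depConst (θ : Param r s) : ℝ :=
  |θ.a0| + (∑ i, |θ.f i|) * (2 * (|θ.a0| + θ.matBound)) + ∑ i, |θ.f i|

theorem sum_abs_f_nonneg : 0 ≤ ∑ i, |θ.f i| := Finset.sum_nonneg fun _ _ => abs_nonneg _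

theorem depConst_nonneg : 0 ≤ θ.depConst := by
  have := θ.matBound_nonneg
  have := θ.sum_abs_f_nonneg
  unfold depConst
  positivity

theorem abs_volFun_le {y : ℕ → ℝ} (h : θ.stateBound y < ⊤) :
    |θ.volFun y| ≤ θ.depConst * (1 + (θ.stateBound y).toReal) := by
  set S := (θ.stateBound y).toReal with hS
  have hS0 : 0 ≤ S := ENNReal.toReal_nonneg
  have hF := θ.sum_abs_f_nonneg
  have hK := θ.matBound_nonneg
  have hd : |θ.a0| + ∑ i, |θ.f i| ≤ θ.depConst := by
    have : 0 ≤ (∑ i, |θ.f i|) * (2 * (|θ.a0| + θ.matBound)) := by positivity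
    unfold depConst; linarith
  calc |θ.volFun y| ≤ |θ.a0| + (∑ i, |θ.f i|) * S := by
        refine (abs_add_le _ _).trans (add_le_add le_rfl ((abs_f_dotProduct_le _).trans ?_))
        exact mul_le_mul_of_nonneg_left (θ.norm_state_le h) hF
    _ ≤ (|θ.a0| + ∑ i, |θ.f i|) * (1 + S) := by nlinarith [mul_nonneg (abs_nonneg θ.a0) hS0]
    _ ≤ _ := mul_le_mul_of_nonneg_right hd (by positivity)

theorem abs_obsFun_le {y : ℕ → ℝ} (h : θ.stateBound (drop 1 y) < ⊤) :
    |θ.obsFun y| ≤ θ.depConst * ((1 + y 0 ^ 2) * (1 + (θ.stateBound (drop 1 y)).toReal)) := by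
  have hS0 : 0 ≤ (θ.stateBound (drop 1 y)).toReal := ENNReal.toReal_nonneg
  rw [obsFun, abs_mul, abs_of_nonneg (sq_nonneg _)]
  have h1 := abs_volFun_le h
  calc y 0 ^ 2 * |θ.volFun (drop 1 y)|
      ≤ (1 + y 0 ^ 2) * (θ.depConst * (1 + (θ.stateBound (drop 1 y)).toReal)) :=
        mul_le_mul (by linarith) h1 (abs_nonneg _) (by positivity)
    _ = _ := by ring

/-- The effect on `obsFun` of replacing the present innovation. -/
theorem abs_obsFun_sub_update_zero_le {y : ℕ → ℝ} (z : ℝ) (h : θ.stateBound (drop 1 y) < ⊤) :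
    |θ.obsFun y - θ.obsFun (Function.update y 0 z)| ≤
      θ.depConst * ((1 + y 0 ^ 2) * (1 + (θ.stateBound (drop 1 y)).toReal) * (1 + z ^ 2)) := by
  have hS0 : 0 ≤ (θ.stateBound (drop 1 y)).toReal := ENNReal.toReal_nonneg
  have hd : drop 1 (Function.update y 0 z) = drop 1 y := by
    funext j; simp only [drop]; exact Function.update_of_ne (by omega) _ _
  have hD := θ.depConst_nonneg
  rw [obsFun, obsFun, hd, Function.update_self, ← sub_mul, abs_mul]
  have h2 : |y 0 ^ 2 - z ^ 2| ≤ (1 + y 0 ^ 2) * (1 + z ^ 2) := by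
    rw [abs_le]
    have := mul_nonneg (sq_nonneg (y 0)) (sq_nonneg z)
    constructor <;> nlinarith [sq_nonneg (y 0), sq_nonneg z]
  calc |y 0 ^ 2 - z ^ 2| * |θ.volFun (drop 1 y)|
      ≤ ((1 + y 0 ^ 2) * (1 + z ^ 2)) *
        (θ.depConst * (1 + (θ.stateBound (drop 1 y)).toReal)) :=
        mul_le_mul h2 (abs_volFun_le h) (abs_nonneg _) (by positivity)
    _ = _ := by ring

/-- The effect on `obsFun` of replacing a past innovation. -/
theorem abs_obsFun_sub_update_succ_le (hθ : θ.IsNonneg) {y : ℕ → ℝ} (k : ℕ) (z : ℝ)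
    (h : θ.stateBound (drop (k + 2) y) < ⊤) :
    |θ.obsFun y - θ.obsFun (Function.update y (k + 1) z)| ≤
      θ.depConst * ((1 + y 0 ^ 2) * (entrySum (θ.pastProd (drop 1 y) k) *
        ((1 + y (k + 1) ^ 2) * (1 + (θ.stateBound (drop (k + 2) y)).toReal))) * (1 + z ^ 2)) := by
  set y' := Function.update y (k + 1) z with hy'
  set S := (θ.stateBound (drop (k + 2) y)).toReal with hS
  have hS0 : 0 ≤ S := ENNReal.toReal_nonneg
  have hF := θ.sum_abs_f_nonneg
  have hK := θ.matBound_nonneg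
  have hN := entrySum_nonneg (θ.pastProd (drop 1 y) k)
  have hne : ∀ j, j ≠ k + 1 → y' j = y j := fun j hj => Function.update_of_ne hj _ _
  have hd1 : ∀ u, drop 1 (drop (k + 1) u) = drop (k + 2) u := fun u => drop_drop _ _ u
  have hdk : ∀ u, drop k (drop 1 u) = drop (k + 1) u := fun u => by rw [drop_drop, Nat.add_comm]
  have hdrop : drop (k + 2) y' = drop (k + 2) y := by
    funext j; exact hne _ (by omega)
  have hg : θ.stateBound (drop 1 (drop (k + 1) y)) < ⊤ := by rw [hd1]; exact h
  have hg' : θ.stateBound (drop 1 (drop (k + 1) y')) < ⊤ := by rw [hd1, hdrop]; exact h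
  have hsub : θ.state (drop 1 y) - θ.state (drop 1 y') =
      (θ.pastProd (drop 1 y) k).mulVec (θ.state (drop (k + 1) y) - θ.state (drop (k + 1) y')) := by
    rw [state_sub_state hθ (m := k) (u := drop 1 y) (u' := drop 1 y')
      (fun j hj => (hne (1 + j) (by omega)).symm), hdk, hdk]
    · rw [hdk]; exact θ.stateBound_lt_top_of_drop_one hg
    · rw [hdk]; exact θ.stateBound_lt_top_of_drop_one hg'
  have hb : ‖θ.state (drop (k + 1) y) - θ.state (drop (k + 1) y')‖ ≤
      2 * (|θ.a0| + θ.matBound) * ((1 + y (k + 1) ^ 2) * (1 + S) * (1 + z ^ 2)) := by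
    have h1 := norm_state_le_of_drop hθ hg
    have h2 := norm_state_le_of_drop hθ hg'
    rw [hd1] at h1
    rw [hd1, hdrop] at h2
    have e1 : drop (k + 1) y 0 = y (k + 1) := rfl
    have e2 : drop (k + 1) y' 0 = z := Function.update_self _ _ _
    rw [e1] at h1
    rw [e2] at h2
    rw [← hS] at h1 h2
    have hA : 0 ≤ (|θ.a0| + θ.matBound) * (1 + S) := by positivity
    -- a + b ≤ 2ab for a, b ≥ 1. A product, unlike a sum, factors under independence.
    have hyz : (1 + y (k + 1) ^ 2) + (1 + z ^ 2) ≤ 2 * ((1 + y (k + 1) ^ 2) * (1 + z ^ 2)) := by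
      nlinarith [mul_nonneg (sq_nonneg (y (k + 1))) (sq_nonneg z), sq_nonneg (y (k + 1)),
        sq_nonneg z]
    calc _ ≤ _ := norm_sub_le _ _
      _ ≤ (|θ.a0| + θ.matBound) * (1 + S) * ((1 + y (k + 1) ^ 2) + (1 + z ^ 2)) := by
        refine (add_le_add h1 h2).trans (le_of_eq ?_); ring
      _ ≤ (|θ.a0| + θ.matBound) * (1 + S) * (2 * ((1 + y (k + 1) ^ 2) * (1 + z ^ 2))) :=
        mul_le_mul_of_nonneg_left hyz hA
      _ = _ := by ring
  have hdiff : θ.obsFun y - θ.obsFun y' =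
      y 0 ^ 2 * (θ.f ⬝ᵥ (θ.state (drop 1 y) - θ.state (drop 1 y'))) := by
    rw [obsFun, obsFun, hne 0 (by omega), volFun, volFun, dotProduct_sub]; ring
  have hconst : (∑ i, |θ.f i|) * (2 * (|θ.a0| + θ.matBound)) ≤ θ.depConst := by
    have := abs_nonneg θ.a0
    unfold depConst; linarith
  rw [hdiff, abs_mul, abs_of_nonneg (sq_nonneg _), hsub]
  set E := (1 + y (k + 1) ^ 2) * (1 + S) * (1 + z ^ 2) with hE
  have hE0 : 0 ≤ E := by positivity
  calc y 0 ^ 2 * |θ.f ⬝ᵥ (θ.pastProd (drop 1 y) k).mulVec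
        (θ.state (drop (k + 1) y) - θ.state (drop (k + 1) y'))|
      ≤ (1 + y 0 ^ 2) * ((∑ i, |θ.f i|) * (entrySum (θ.pastProd (drop 1 y) k) *
          (2 * (|θ.a0| + θ.matBound) * E))) := by
        refine mul_le_mul (by linarith) ((abs_f_dotProduct_le _).trans ?_) (abs_nonneg _)
          (by positivity)
        refine mul_le_mul_of_nonneg_left ((norm_mulVec_le _ _).trans ?_) hF
        exact mul_le_mul_of_nonneg_left hb hN
    _ = (∑ i, |θ.f i|) * (2 * (|θ.a0| + θ.matBound)) *
          ((1 + y 0 ^ 2) * (entrySum (θ.pastProd (drop 1 y) k) * E)) := by ring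
    _ ≤ θ.depConst * ((1 + y 0 ^ 2) * (entrySum (θ.pastProd (drop 1 y) k) * E)) :=
        mul_le_mul_of_nonneg_right hconst (by positivity)
    _ = _ := by rw [hE]; ring

end Dependence

end Param

end GarchModel

/-! ### Moments and functional dependence of the causal solution. -/

namespace GarchModel

theorem past_update (x : ℤ → ℝ) (k : ℕ) (z : ℝ) :
    past (Function.update x 0 z) k = Function.update (past x k) k z := by
  funext j
  by_cases hj : j = k
  · subst hj
    simp [past]
  · rw [Function.update_of_ne hj]
    simp only [past]
    exact Function.update_of_ne (by omega) _ _

theorem eLpNorm_ofReal_le_rpow {Ω : Type*} [MeasurableSpace Ω] {P : Measure Ω} {f : Ω → ℝ} {q : ℝ}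
    (hq : 0 < q) {B : ENNReal} (h : ∫⁻ ω, ‖f ω‖ₑ ^ q ∂P ≤ B) :
    eLpNorm f (ENNReal.ofReal q) P ≤ B ^ (1 / q) := by
  rw [eLpNorm_eq_lintegral_rpow_enorm_toReal (ENNReal.ofReal_pos.2 hq).ne' ENNReal.ofReal_ne_top,
    ENNReal.toReal_ofReal hq.le]
  exact ENNReal.rpow_le_rpow h (by positivity)

namespace Param

variable {r s : ℕ}

section Moments

variable (θ : Param r s) (μ : Measure ℝ)

/-- The `q`-th moment of one plus the norm bound of the state vector. -/
noncomputable def stateMoment (q : ℝ) : ENNReal := ∫⁻ y, (1 + θ.stateBound y) ^ q ∂(seqLaw μ)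

theorem measurable_one_add_stateBound_rpow (q : ℝ) :
    Measurable fun y => (1 + θ.stateBound y) ^ q :=
  (measurable_const.add θ.measurable_stateBound).pow_const q

theorem ofReal_one_add_toReal_le (S : ENNReal) : ENNReal.ofReal (1 + S.toReal) ≤ 1 + S := by
  rw [ENNReal.ofReal_add zero_le_one ENNReal.toReal_nonneg, ENNReal.ofReal_one]
  exact add_le_add le_rfl ENNReal.ofReal_toReal_le

variable {θ μ}

theorem stateMoment_lt_top [IsProbabilityMeasure μ]
    {q : ℝ} (hq : 0 < q) (hq1 : q ≤ 1)
    (h : ∫⁻ y, θ.stateBound y ^ q ∂(seqLaw μ) < ⊤) : θ.stateMoment μ q < ⊤ := by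
  calc θ.stateMoment μ q ≤ ∫⁻ y, (1 + θ.stateBound y ^ q) ∂(seqLaw μ) := by
        refine lintegral_mono fun y => ?_
        simpa using ENNReal.rpow_add_le_add_rpow 1 (θ.stateBound y) hq.le hq1
    _ < ⊤ := by
        rw [lintegral_add_left measurable_const]
        simpa using h

/-- The weight of the present innovation together with the bound on the preceding state. -/
noncomputable def presentWeight (θ : Param r s) (q : ℝ) (y : ℕ → ℝ) : ENNReal :=
  ENNReal.ofReal (1 + y 0 ^ 2) ^ q * (1 + θ.stateBound (drop 1 y)) ^ q

theorem measurable_presentWeight (q : ℝ) : Measurable (θ.presentWeight q) := by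
  have h1 : Measurable fun y : ℕ → ℝ => ENNReal.ofReal (1 + y 0 ^ 2) ^ q := by fun_prop
  exact h1.mul ((θ.measurable_one_add_stateBound_rpow q).comp (measurable_drop 1))

theorem lintegral_weight_mul_drop_one_le [IsProbabilityMeasure μ]
    (hμ : ∫⁻ z, ENNReal.ofReal (z ^ 2) ∂μ = 1) {q : ℝ}
    (hq1 : q ≤ 1) {R : (ℕ → ℝ) → ENNReal} (hR : Measurable R) :
    ∫⁻ y, ENNReal.ofReal (1 + y 0 ^ 2) ^ q * R (drop 1 y) ∂(seqLaw μ) ≤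
      2 * ∫⁻ y, R y ∂(seqLaw μ) := by
  have h1 : Measurable fun y : ℕ → ℝ => ENNReal.ofReal (1 + y 0 ^ 2) ^ q := by fun_prop
  rw [lintegral_mul_comp_drop μ 1 h1 hR fun y y' h => by rw [h 0 one_pos],
    lintegral_comp_eval μ 0 (g := fun z => ENNReal.ofReal (1 + z ^ 2) ^ q) (by fun_prop)]
  gcongr
  exact lintegral_one_add_sq_rpow_le hμ hq1

theorem lintegral_presentWeight_le [IsProbabilityMeasure μ]
    (hμ : ∫⁻ z, ENNReal.ofReal (z ^ 2) ∂μ = 1) {q : ℝ}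
    (hq1 : q ≤ 1) : ∫⁻ y, θ.presentWeight q y ∂(seqLaw μ) ≤ 2 * θ.stateMoment μ q :=
  lintegral_weight_mul_drop_one_le hμ hq1 (θ.measurable_one_add_stateBound_rpow q)

/-- The weight in the bound for the effect of replacing the innovation `k + 1` steps ago. -/
noncomputable def lagWeight (θ : Param r s) (q : ℝ) (k : ℕ) (y : ℕ → ℝ) : ENNReal :=
  ENNReal.ofReal (entrySum (θ.pastProd y k)) ^ q * θ.presentWeight q (drop k y)

theorem measurable_lagWeight (q : ℝ) (k : ℕ) : Measurable (θ.lagWeight q k) :=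
  (θ.measurable_ofReal_entrySum_rpow q k).mul
    ((measurable_presentWeight q).comp (measurable_drop k))

/-- The first k innovations, the next one and the remaining past are independent; only the first
block carries the decay. -/
theorem lintegral_lagWeight_le [IsProbabilityMeasure μ]
    (hμ : ∫⁻ z, ENNReal.ofReal (z ^ 2) ∂μ = 1) {q : ℝ}
    (hq1 : q ≤ 1) (k : ℕ) : ∫⁻ y, θ.lagWeight q k y ∂(seqLaw μ) ≤
      θ.prodMoment μ q k * (2 * θ.stateMoment μ q) := by
  unfold lagWeight
  rw [lintegral_mul_comp_drop μ k (θ.measurable_ofReal_entrySum_rpow q k)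
    (measurable_presentWeight q) fun y y' h => by rw [θ.pastProd_congr h]]
  exact mul_le_mul' le_rfl (lintegral_presentWeight_le hμ hq1)

theorem enorm_rpow_le {q : ℝ} (hq : 0 ≤ q) {x D E : ℝ} (hD : 0 ≤ D) (h : |x| ≤ D * E) :
    ‖x‖ₑ ^ q ≤ ENNReal.ofReal D ^ q * ENNReal.ofReal E ^ q := by
  rw [← ENNReal.mul_rpow_of_nonneg _ _ hq, ← ENNReal.ofReal_mul hD, Real.enorm_eq_ofReal_abs]
  exact ENNReal.rpow_le_rpow (ENNReal.ofReal_le_ofReal h) hq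

theorem ofReal_present_rpow_le {q : ℝ} (hq : 0 ≤ q) (y : ℕ → ℝ) :
    ENNReal.ofReal ((1 + y 0 ^ 2) * (1 + (θ.stateBound (drop 1 y)).toReal)) ^ q ≤
      θ.presentWeight q y := by
  rw [ENNReal.ofReal_mul (by positivity), ENNReal.mul_rpow_of_nonneg _ _ hq]
  exact mul_le_mul' le_rfl (ENNReal.rpow_le_rpow (ofReal_one_add_toReal_le _) hq)

theorem enorm_obsFun_rpow_le {q : ℝ} (hq : 0 ≤ q) {y : ℕ → ℝ}
    (h : θ.stateBound (drop 1 y) < ⊤) :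
    ‖θ.obsFun y‖ₑ ^ q ≤ ENNReal.ofReal θ.depConst ^ q * θ.presentWeight q y :=
  (enorm_rpow_le hq depConst_nonneg (abs_obsFun_le h)).trans
    (mul_le_mul' le_rfl (ofReal_present_rpow_le hq y))

theorem enorm_obsFun_sub_update_zero_rpow_le {q : ℝ} (hq : 0 ≤ q) {y : ℕ → ℝ} (z : ℝ)
    (h : θ.stateBound (drop 1 y) < ⊤) :
    ‖θ.obsFun y - θ.obsFun (Function.update y 0 z)‖ₑ ^ q ≤
      ENNReal.ofReal θ.depConst ^ q * (θ.presentWeight q y * ENNReal.ofReal (1 + z ^ 2) ^ q) := by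
  refine (enorm_rpow_le hq depConst_nonneg (abs_obsFun_sub_update_zero_le z h)).trans
    (mul_le_mul' le_rfl ?_)
  rw [ENNReal.ofReal_mul (by positivity), ENNReal.mul_rpow_of_nonneg _ _ hq]
  exact mul_le_mul' (ofReal_present_rpow_le hq y) le_rfl

theorem enorm_obsFun_sub_update_succ_rpow_le (hθ : θ.IsNonneg) {q : ℝ} (hq : 0 ≤ q) {y : ℕ → ℝ}
    (k : ℕ) (z : ℝ) (h : θ.stateBound (drop (k + 2) y) < ⊤) :
    ‖θ.obsFun y - θ.obsFun (Function.update y (k + 1) z)‖ₑ ^ q ≤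
      ENNReal.ofReal θ.depConst ^ q * ((ENNReal.ofReal (1 + y 0 ^ 2) ^ q *
        θ.lagWeight q k (drop 1 y)) * ENNReal.ofReal (1 + z ^ 2) ^ q) := by
  refine (enorm_rpow_le hq depConst_nonneg (abs_obsFun_sub_update_succ_le hθ k z h)).trans
    (mul_le_mul' le_rfl ?_)
  have hN := entrySum_nonneg (θ.pastProd (drop 1 y) k)
  rw [ENNReal.ofReal_mul (by positivity), ENNReal.mul_rpow_of_nonneg _ _ hq,
    ENNReal.ofReal_mul (by positivity), ENNReal.mul_rpow_of_nonneg _ _ hq,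
    ENNReal.ofReal_mul hN, ENNReal.mul_rpow_of_nonneg _ _ hq]
  refine mul_le_mul' (mul_le_mul' le_rfl (mul_le_mul' le_rfl ?_)) le_rfl
  have h1 : drop k (drop 1 y) = drop (k + 1) y := by rw [drop_drop, Nat.add_comm]
  have h2 : drop 1 (drop (k + 1) y) = drop (k + 2) y := drop_drop _ _ _
  have h3 := ofReal_present_rpow_le (θ := θ) hq (drop (k + 1) y)
  rw [h2] at h3
  rw [h1]
  exact h3

end Moments

section CausalSolution

variable {Ω : Type*} [MeasurableSpace Ω] {P : Measure Ω} {ζ : ℤ → Ω → ℝ}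
  {θ : Param r s}

theorem ae_past_of_ae_seqLaw [IsProbabilityMeasure P] (hζ : IsInnovation P ζ) {p : (ℕ → ℝ) → Prop}
    (h : ∀ᵐ y ∂(seqLaw (P.map (ζ 0))), p y) :
    ∀ᵐ ω ∂P, ∀ i : ℤ, p (past (fun n => ζ n ω) i) := by
  refine ae_all_iff.2 fun i => ?_
  rw [← hζ.map_past i] at h
  exact ae_of_ae_map (hζ.measurable_past_path i).aemeasurable h

theorem lintegral_comp_past [IsProbabilityMeasure P] (hζ : IsInnovation P ζ) {F : (ℕ → ℝ) → ENNReal} (hF : Measurable F)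
    (i : ℤ) : ∫⁻ ω, F (past (fun n => ζ n ω) i) ∂P = ∫⁻ y, F y ∂(seqLaw (P.map (ζ 0))) := by
  rw [← hζ.map_past i, lintegral_map hF (hζ.measurable_past_path i)]

theorem eLpNorm_obsFun_lt_top [IsProbabilityMeasure P]
    (hζ : IsInnovation P ζ) {q : ℝ} (hq : 0 < q) (hq1 : q ≤ 1)
    (hgood : ∀ᵐ ω ∂P, ∀ i : ℤ, θ.stateBound (past (fun n => ζ n ω) i) < ⊤)
    (hfin : θ.stateMoment (P.map (ζ 0)) q < ⊤) :
    eLpNorm (causal ζ θ.obsFun 0) (ENNReal.ofReal q) P < ⊤ := by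
  have := hζ.isProbabilityMeasure_law
  refine (eLpNorm_ofReal_le_rpow hq
    (B := ENNReal.ofReal θ.depConst ^ q * (2 * θ.stateMoment (P.map (ζ 0)) q)) ?_).trans_lt ?_
  · calc ∫⁻ ω, ‖causal ζ θ.obsFun 0 ω‖ₑ ^ q ∂P
        ≤ ∫⁻ ω, ENNReal.ofReal θ.depConst ^ q *
          θ.presentWeight q (past (fun n => ζ n ω) 0) ∂P := by
          refine lintegral_mono_ae ?_
          filter_upwards [hgood] with ω hω
          refine enorm_obsFun_rpow_le hq.le ?_
          rw [drop_past]
          exact hω _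
      _ = ENNReal.ofReal θ.depConst ^ q *
          ∫⁻ y, θ.presentWeight q y ∂(seqLaw (P.map (ζ 0))) := by
          have hm : Measurable fun ω => θ.presentWeight q (past (fun n => ζ n ω) 0) :=
            (measurable_presentWeight q).comp (hζ.measurable_past_path 0)
          rw [lintegral_const_mul _ hm, lintegral_comp_past hζ (measurable_presentWeight q)]
      _ ≤ _ := mul_le_mul' le_rfl (lintegral_presentWeight_le hζ.lintegral_sq hq1)
  · refine ENNReal.rpow_lt_top_of_nonneg (by positivity) (ENNReal.mul_lt_top ?_ ?_).ne
    · exact ENNReal.rpow_lt_top_of_nonneg hq.le ENNReal.ofReal_ne_top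
    · exact ENNReal.mul_lt_top (by norm_num) hfin

/-- Common to lag zero and positive lags: the pathwise bound is a functional of the past times a
weight of the independent copy, and that weight has expectation at most 2. -/
theorem lintegral_update_le [IsProbabilityMeasure P]
    (hζ : IsInnovation P ζ) {q : ℝ} (hq1 : q ≤ 1)
    (hgood : ∀ᵐ ω ∂P, ∀ i : ℤ, θ.stateBound (past (fun n => ζ n ω) i) < ⊤) {k m : ℕ}
    {Φ : (ℕ → ℝ) → ENNReal} (hΦ : Measurable Φ) {D B : ENNReal}
    (hB : ∫⁻ y, Φ y ∂(seqLaw (P.map (ζ 0))) ≤ B)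
    (hle : ∀ y z, θ.stateBound (drop m y) < ⊤ →
      ‖θ.obsFun y - θ.obsFun (Function.update y k z)‖ₑ ^ q ≤
        D * (Φ y * ENNReal.ofReal (1 + z ^ 2) ^ q)) :
    ∫⁻ p : Ω × ℝ, ‖θ.obsFun (past (fun n => ζ n p.1) k)
      - θ.obsFun (past (Function.update (fun n => ζ n p.1) 0 p.2) k)‖ₑ ^ q
        ∂(P.prod (P.map (ζ 0))) ≤ D * (B * 2) := by
  have := hζ.isProbabilityMeasure_law
  have hm1 : Measurable fun ω => Φ (past (fun n => ζ n ω) k) :=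
    hΦ.comp (hζ.measurable_past_path k)
  have hm2 : Measurable fun z : ℝ => ENNReal.ofReal (1 + z ^ 2) ^ q := by fun_prop
  calc _ ≤ ∫⁻ p : Ω × ℝ, D * (Φ (past (fun n => ζ n p.1) k) *
          ENNReal.ofReal (1 + p.2 ^ 2) ^ q) ∂(P.prod (P.map (ζ 0))) := by
        refine lintegral_mono_ae ?_
        filter_upwards [Measure.quasiMeasurePreserving_fst.ae hgood] with p hp
        rw [past_update]
        refine hle _ _ ?_
        rw [drop_past]
        exact hp _
    _ = D * ((∫⁻ y, Φ y ∂(seqLaw (P.map (ζ 0)))) *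
          ∫⁻ z, ENNReal.ofReal (1 + z ^ 2) ^ q ∂(P.map (ζ 0))) := by
        have hm3 : Measurable fun p : Ω × ℝ => Φ (past (fun n => ζ n p.1) k) *
            ENNReal.ofReal (1 + p.2 ^ 2) ^ q :=
          (hm1.comp measurable_fst).mul (hm2.comp measurable_snd)
        rw [lintegral_const_mul _ hm3, lintegral_prod_mul hm1.aemeasurable hm2.aemeasurable, lintegral_comp_past hζ hΦ]
    _ ≤ D * (B * 2) :=
        mul_le_mul' le_rfl (mul_le_mul' hB (lintegral_one_add_sq_rpow_le hζ.lintegral_sq hq1))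

theorem exists_functionalDependence_le [IsProbabilityMeasure P]
    (hζ : IsInnovation P ζ) (hθ : θ.IsNonneg) {q : ℝ}
    (hq : 0 < q) (hq1 : q ≤ 1)
    (hgood : ∀ᵐ ω ∂P, ∀ i : ℤ, θ.stateBound (past (fun n => ζ n ω) i) < ⊤)
    (hfin : θ.stateMoment (P.map (ζ 0)) q < ⊤) {C c : ℝ} (hC : 0 ≤ C) (hc0 : 0 < c) (hc1 : c < 1)
    (hmom : ∀ n, θ.prodMoment (P.map (ζ 0)) q n ≤ ENNReal.ofReal (C * c ^ n)) :
    ∃ c : ℝ, 0 < c ∧ c < 1 ∧ ∃ C : ℝ, ∀ k : ℕ,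
      functionalDependence P ζ θ.obsFun q k ≤ ENNReal.ofReal (C * c ^ k) := by
  have := hζ.isProbabilityMeasure_law
  set τ := θ.stateMoment (P.map (ζ 0)) q with hτ
  set D := ENNReal.ofReal θ.depConst ^ q with hD
  have hDτ : D * τ ≠ ⊤ := ENNReal.mul_ne_top
    (ENNReal.rpow_ne_top_of_nonneg hq.le ENNReal.ofReal_ne_top) hfin.ne
  set A : ℝ := (D * τ).toReal with hA
  have hA0 : 0 ≤ A := ENNReal.toReal_nonneg
  have hAe : ENNReal.ofReal A = D * τ := ENNReal.ofReal_toReal hDτ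
  -- The first term serves lag 0. The second serves lag k + 1, where only k matrices contract; hence
  -- the division by `c`.
  set M : ℝ := 4 * A + 8 * A * C / c with hM
  have hM0 : 0 ≤ M := by positivity
  refine ⟨c ^ (1 / q), by positivity, Real.rpow_lt_one hc0.le hc1 (by positivity),
    M ^ (1 / q), fun k => ?_⟩
  have hfinal : ENNReal.ofReal (M ^ (1 / q) * (c ^ (1 / q)) ^ k) =
      ENNReal.ofReal (M * c ^ k) ^ (1 / q) := by
    rw [ENNReal.ofReal_rpow_of_nonneg (by positivity) (by positivity),
      Real.mul_rpow hM0 (by positivity), ← Real.rpow_natCast (c ^ (1 / q)), ← Real.rpow_mul hc0.le,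
      mul_comm (1 / q), Real.rpow_mul hc0.le, Real.rpow_natCast]
  rw [hfinal]
  refine eLpNorm_ofReal_le_rpow hq ?_
  rcases k with _ | k
  · refine (lintegral_update_le hζ hq1 hgood (k := 0) (m := 1) (measurable_presentWeight q)
      (lintegral_presentWeight_le hζ.lintegral_sq hq1)
      fun y z h => enorm_obsFun_sub_update_zero_rpow_le hq.le z h).trans ?_
    calc D * (2 * τ * 2) = ENNReal.ofReal 4 * ENNReal.ofReal A := by
          rw [hAe, ENNReal.ofReal_ofNat, show (4 : ENNReal) = 2 * 2 by norm_num]; ring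
      _ = ENNReal.ofReal (4 * A) := (ENNReal.ofReal_mul (by norm_num)).symm
      _ ≤ _ := by
          refine ENNReal.ofReal_le_ofReal ?_
          have : 0 ≤ 8 * A * C / c := by positivity
          rw [pow_zero, mul_one]; linarith
  · have hw : Measurable fun y : ℕ → ℝ => ENNReal.ofReal (1 + y 0 ^ 2) ^ q := by fun_prop
    refine (lintegral_update_le hζ hq1 hgood (k := k + 1) (m := k + 2)
      (hw.mul ((measurable_lagWeight q k).comp (measurable_drop 1)))
      ((lintegral_weight_mul_drop_one_le hζ.lintegral_sq hq1 (measurable_lagWeight q k)).trans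
        (mul_le_mul' le_rfl ((lintegral_lagWeight_le hζ.lintegral_sq hq1 k).trans
          (mul_le_mul' (hmom k) le_rfl))))
      fun y z h => enorm_obsFun_sub_update_succ_rpow_le hθ hq.le k z h).trans ?_
    calc D * (2 * (ENNReal.ofReal (C * c ^ k) * (2 * τ)) * 2)
        = ENNReal.ofReal 8 * ENNReal.ofReal A * ENNReal.ofReal (C * c ^ k) := by
          rw [hAe, ENNReal.ofReal_ofNat, show (8 : ENNReal) = 2 * 2 * 2 by norm_num]; ring
      _ = ENNReal.ofReal (8 * A * (C * c ^ k)) := by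
          rw [ENNReal.ofReal_mul (p := 8 * A) (by positivity),
            ENNReal.ofReal_mul (p := 8) (by norm_num)]
      _ ≤ _ := by
          refine ENNReal.ofReal_le_ofReal ?_
          have h1 : 8 * A * (C * c ^ k) = 8 * A * C / c * c ^ (k + 1) := by
            rw [pow_succ]; field_simp
          rw [h1]
          refine mul_le_mul_of_nonneg_right ?_ (by positivity)
          rw [hM]; linarith

end CausalSolution

end Param

end GarchModel

namespace GarchModel

/-! ### Tightness of families of random variables. -/

section Tightness

variable {Ω : Type*} [MeasurableSpace Ω] {P : Measure Ω}

/-- A family of random variables which is uniformly bounded in probability. -/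
def IsTightFamily (P : Measure Ω) (W : ℤ → Ω → ℝ) : Prop :=
  ∀ ε : ENNReal, 0 < ε → ∃ M : ℝ, ∀ i, P {ω | M < |W i ω|} ≤ ε

theorem exists_measure_abs_gt_le [IsFiniteMeasure P] {W : Ω → ℝ} (hW : AEMeasurable W P)
    {ε : ENNReal} (hε : 0 < ε) : ∃ M : ℝ, P {ω | M < |W ω|} ≤ ε := by
  obtain ⟨V, hV, hWV⟩ := hW
  have hlim : Tendsto (fun n : ℕ => P {ω | (n : ℝ) < |V ω|}) atTop (𝓝 (P ∅)) := by
    refine tendsto_measure_of_ae_tendsto_indicator_of_isFiniteMeasure atTop MeasurableSet.empty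
      (fun n => measurableSet_lt measurable_const hV.abs) (ae_of_all _ fun ω => ?_)
    filter_upwards [tendsto_natCast_atTop_atTop.eventually_ge_atTop |V ω|] with n hn
    simpa using hn
  rw [measure_empty] at hlim
  obtain ⟨n, hn⟩ := (hlim.eventually_lt_const hε).exists
  refine ⟨n, (measure_mono_ae ?_).trans hn.le⟩
  filter_upwards [hWV] with ω hω h
  change (n : ℝ) < |V ω|
  rw [← hω]
  exact h

namespace IsTightFamily

theorem mono {V W : ℤ → Ω → ℝ} (hV : IsTightFamily P V)
    (h : ∀ i, ∀ᵐ ω ∂P, |W i ω| ≤ |V i ω|) : IsTightFamily P W := fun ε hε => by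
  obtain ⟨M, hM⟩ := hV ε hε
  refine ⟨M, fun i => (measure_mono_ae ?_).trans (hM i)⟩
  filter_upwards [h i] with ω hω hlt
  exact lt_of_lt_of_le hlt hω

theorem const (P : Measure Ω) (c : ℝ) : IsTightFamily P fun _ _ => c := fun ε _ =>
  ⟨|c|, fun i => by simp⟩

theorem add {V W : ℤ → Ω → ℝ} (hV : IsTightFamily P V) (hW : IsTightFamily P W) :
    IsTightFamily P fun i ω => V i ω + W i ω := fun ε hε => by
  obtain ⟨M, hM⟩ := hV (ε / 2) (ENNReal.half_pos hε.ne')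
  obtain ⟨N, hN⟩ := hW (ε / 2) (ENNReal.half_pos hε.ne')
  refine ⟨M + N, fun i => ?_⟩
  calc P {ω | M + N < |V i ω + W i ω|} ≤ P ({ω | M < |V i ω|} ∪ {ω | N < |W i ω|}) := by
        refine measure_mono fun ω hω => ?_
        by_contra hcon
        simp only [Set.mem_union, Set.mem_ofPred_eq, not_or, not_lt] at hcon hω
        have := abs_add_le (V i ω) (W i ω)
        linarith [hcon.1, hcon.2]
    _ ≤ ε / 2 + ε / 2 := (measure_union_le _ _).trans (add_le_add (hM i) (hN i))
    _ = ε := ENNReal.add_halves ε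

theorem const_mul {V : ℤ → Ω → ℝ} (hV : IsTightFamily P V) (c : ℝ) :
    IsTightFamily P fun i ω => c * V i ω := fun ε hε => by
  obtain ⟨M, hM⟩ := hV ε hε
  refine ⟨|c| * M, fun i => (measure_mono fun ω hω => ?_).trans (hM i)⟩
  simp only [Set.mem_ofPred_eq, abs_mul] at hω ⊢
  exact lt_of_mul_lt_mul_left hω (abs_nonneg c)

theorem abs {V : ℤ → Ω → ℝ} (hV : IsTightFamily P V) : IsTightFamily P fun i ω => |V i ω| :=
  hV.mono fun i => ae_of_all _ fun ω => by rw [abs_abs]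

theorem shift {V : ℤ → Ω → ℝ} (hV : IsTightFamily P V) (k : ℤ) :
    IsTightFamily P fun i ω => V (i - k) ω := fun ε hε => by
  obtain ⟨M, hM⟩ := hV ε hε
  exact ⟨M, fun i => hM _⟩

theorem sum {κ : Type*} (t : Finset κ) {V : κ → ℤ → Ω → ℝ} (hV : ∀ k, IsTightFamily P (V k)) :
    IsTightFamily P fun i ω => ∑ k ∈ t, V k i ω := by
  classical
  induction t using Finset.induction_on with
  | empty => simpa using const P 0
  | insert a t ha ih =>
    simp only [Finset.sum_insert ha]
    exact (hV a).add ih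

theorem of_isStrictlyStationary [IsFiniteMeasure P] {X : ℤ → Ω → ℝ} (hm : ∀ i, AEMeasurable (X i) P)
    (hX : IsStrictlyStationary P X) : IsTightFamily P X := fun ε hε => by
  obtain ⟨M, hM⟩ := exists_measure_abs_gt_le (hm 0) hε
  refine ⟨M, fun i => ?_⟩
  have h := ((hX i).comp (measurable_pi_apply (0 : ℤ))).measure_mem_eq
    (s := {x : ℝ | M < |x|}) (measurableSet_lt measurable_const measurable_id.abs)
  simp only [Function.comp_def, zero_add] at h
  exact h.le.trans hM

end IsTightFamily

end Tightness

/-! ### Uniqueness of the solution. -/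

section Uniqueness

variable {r s : ℕ} {Ω : Type*} [MeasurableSpace Ω] {P : Measure Ω} {ζ : ℤ → Ω → ℝ}
  {θ : Param r s}

theorem IsGarchSolution.ae_isPathSolution {X2 σ2 : ℤ → Ω → ℝ}
    (h : IsGarchSolution P ζ θ X2 σ2) :
    ∀ᵐ ω ∂P, θ.IsPathSolution (fun i => ζ i ω) (fun i => X2 i ω) (fun i => σ2 i ω) := by
  filter_upwards [ae_all_iff.2 h.observation, ae_all_iff.2 h.volatility] with ω h1 h2
  exact ⟨h1, h2⟩

/-- Along a subsequence of times, the volatility decreases at most geometrically. -/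
theorem Param.IsPathSolution.pow_mul_le (hθ : θ.IsNonneg) {x X σ : ℤ → ℝ}
    (h : θ.IsPathSolution x X σ) (hσ : ∀ i, 0 ≤ σ i) (k : Fin s) (i : ℤ) (l : ℕ) :
    θ.β k ^ l * σ i ≤ σ (i + l * ((k : ℕ) + 1)) := by
  induction l with
  | zero => simp
  | succ l ih =>
    have hX : ∀ i, 0 ≤ X i := fun i => by
      rw [h.observation]; exact mul_nonneg (sq_nonneg _) (hσ i)
    have h1 : θ.β k * σ (i + l * ((k : ℕ) + 1)) ≤ σ (i + (l + 1 : ℕ) * ((k : ℕ) + 1)) := by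
      rw [h.volatility (i + (l + 1 : ℕ) * ((k : ℕ) + 1))]
      have h2 := Finset.single_le_sum (f := fun k' : Fin s =>
        θ.β k' * σ (i + (l + 1 : ℕ) * ((k : ℕ) + 1) - ((k' : ℕ) + 1)))
        (fun k' _ => mul_nonneg (hθ.β k') (hσ _)) (Finset.mem_univ k)
      have h3 : 0 ≤ ∑ j : Fin r, θ.α j * X (i + (l + 1 : ℕ) * ((k : ℕ) + 1) - ((j : ℕ) + 1)) :=
        Finset.sum_nonneg fun j _ => mul_nonneg (hθ.α j) (hX _)
      have h4 : i + (l + 1 : ℕ) * ((k : ℕ) + 1 : ℤ) - ((k : ℕ) + 1) = i + l * ((k : ℕ) + 1) := by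
        push_cast; ring
      simp only [h4] at h2
      linarith [hθ.a0]
    calc θ.β k ^ (l + 1) * σ i = θ.β k * (θ.β k ^ l * σ i) := by ring
      _ ≤ θ.β k * σ (i + l * ((k : ℕ) + 1)) := mul_le_mul_of_nonneg_left ih (hθ.β k)
      _ ≤ _ := h1

/-- Otherwise ζ_0² ≤ 1/2 almost surely, against 𝔼 ζ_0² = 1. -/
theorem IsInnovation.exists_sq_le_lt_one [IsProbabilityMeasure P] (hζ : IsInnovation P ζ) :
    ∃ ε : ℝ, 0 < ε ∧ P.map (ζ 0) {z | z ^ 2 ≤ ε} < 1 := by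
  have := hζ.isProbabilityMeasure_law
  by_contra! hcon
  have hpos : ∀ ε : ℝ, 0 < ε → ∀ᵐ z ∂(P.map (ζ 0)), z ^ 2 ≤ ε := fun ε hε => by
    have hm : MeasurableSet {z : ℝ | z ^ 2 ≤ ε} :=
      measurableSet_le (by fun_prop) measurable_const
    exact (prob_compl_eq_zero_iff hm).2 (le_antisymm prob_le_one (hcon ε hε))
  have h1 : ∫⁻ z, ENNReal.ofReal (z ^ 2) ∂(P.map (ζ 0)) ≤ ∫⁻ _, ENNReal.ofReal (1 / 2)
      ∂(P.map (ζ 0)) := by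
    refine lintegral_mono_ae ?_
    filter_upwards [hpos (1 / 2) (by norm_num)] with z hz
    exact ENNReal.ofReal_le_ofReal hz
  rw [hζ.lintegral_sq, lintegral_const, measure_univ, mul_one, ← ENNReal.ofReal_one,
    ENNReal.ofReal_le_ofReal_iff (by norm_num)] at h1
  norm_num at h1

theorem IsInnovation.measure_forall_mem [IsProbabilityMeasure P] (hζ : IsInnovation P ζ)
    {f : ℕ → ℤ} (hf : f.Injective) {T : Set ℝ} (hT : MeasurableSet T) (L : ℕ) :
    P {ω | ∀ l < L, ζ (f l) ω ∈ T} = (P.map (ζ 0) T) ^ L := by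
  have := hζ.isProbabilityMeasure_law
  have hm : Measurable fun ω (l : ℕ) => ζ (f l) ω :=
    measurable_pi_lambda _ fun l => hζ.measurable _
  have hpi := Measure.infinitePi_pi (fun _ : ℕ => P.map (ζ 0)) (s := Finset.range L)
    (t := fun _ => T) fun _ _ => hT
  rw [← hζ.map_comp_path hf, Measure.map_apply hm
    (MeasurableSet.pi (Finset.range L).countable_toSet fun _ _ => hT), Finset.prod_const,
    Finset.card_range] at hpi
  rw [← hpi]
  congr 1
  ext ω
  simp [Set.mem_pi]

/-- The volatility of a solution with stationary observations is bounded in probability: a large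
value persists for several periods, and is then likely to be seen in one of the observations. -/
theorem IsGarchSolution.isTightFamily_volatility [IsProbabilityMeasure P] (hζ : IsInnovation P ζ)
    (hθ : θ.IsNonneg) (hβ : ∑ k, θ.β k < 1) {X2 σ2 : ℤ → Ω → ℝ}
    (h : IsGarchSolution P ζ θ X2 σ2) (hX : IsTightFamily P X2) : IsTightFamily P σ2 := by
  -- Without a positive β_k nothing persists, but then σ² is an affine function of finitely many X².
  by_cases hzero : ∀ k, θ.β k = 0
  · have ht : IsTightFamily P fun i ω => θ.a0 + ∑ j : Fin r, θ.α j * X2 (i - ((j : ℕ) + 1)) ω :=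
      (IsTightFamily.const P θ.a0).add
        (IsTightFamily.sum _ fun j : Fin r => (hX.shift ((j : ℕ) + 1)).const_mul (θ.α j))
    refine ht.mono fun i => ?_
    filter_upwards [h.volatility i] with ω hω
    rw [hω]
    simp [hzero]
  · push Not at hzero
    obtain ⟨k, hk⟩ := hzero
    have hk0 : 0 < θ.β k := lt_of_le_of_ne (hθ.β k) hk.symm
    have hk1 : θ.β k ≤ 1 :=
      (Finset.single_le_sum (fun k _ => hθ.β k) (Finset.mem_univ k)).trans hβ.le
    obtain ⟨e, he0, he1⟩ := hζ.exists_sq_le_lt_one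
    intro ε hε
    have hT : MeasurableSet {z : ℝ | z ^ 2 ≤ e} :=
      measurableSet_le (by fun_prop) measurable_const
    have hε2 : 0 < ε / 2 := ENNReal.half_pos hε.ne'
    -- L independent innovations are all small with probability below ε/2.
    obtain ⟨L, hL⟩ := ((ENNReal.tendsto_pow_atTop_nhds_zero_of_lt_one he1).eventually_lt_const
      hε2).exists
    -- A union bound over L observations costs at most ε/2; `L + 1` avoids division by zero.
    obtain ⟨M, hM⟩ := hX (ε / 2 / (L + 1 : ℕ))
      (ENNReal.div_pos hε2.ne' (ENNReal.natCast_ne_top _))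
    set M₀ : ℝ := max M 0 with hM₀
    have hM₀0 : 0 ≤ M₀ := le_max_right _ _
    have hpL : 0 < θ.β k ^ L := pow_pos hk0 L
    -- Above this level, σ² at the l-th later time is at least β_k^L σ_i², so a squared innovation
    -- exceeding e there forces X² > M.
    refine ⟨M₀ / (e * θ.β k ^ L), fun i => ?_⟩
    have hinj : Function.Injective fun l : ℕ => i + l * ((k : ℕ) + 1 : ℤ) := fun a b hab => by
      have hne : ((k : ℕ) + 1 : ℤ) ≠ 0 := by positivity
      simpa [hne] using hab
    have hsub : P {ω | M₀ / (e * θ.β k ^ L) < |σ2 i ω|} ≤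
        P ({ω | ∀ l < L, ζ (i + l * ((k : ℕ) + 1 : ℤ)) ω ∈ {z : ℝ | z ^ 2 ≤ e}} ∪
          ⋃ l ∈ Finset.range L, {ω | M < |X2 (i + l * ((k : ℕ) + 1 : ℤ)) ω|}) := by
      refine measure_mono_ae ?_
      filter_upwards [h.ae_isPathSolution, ae_all_iff.2 h.nonneg] with ω hω hσ hlt
      replace hlt : M₀ / (e * θ.β k ^ L) < σ2 i ω := by
        rw [← abs_of_nonneg (hσ i)]; exact hlt
      rw [div_lt_iff₀ (by positivity)] at hlt
      by_cases hall : ∀ l < L, ζ (i + l * ((k : ℕ) + 1 : ℤ)) ω ^ 2 ≤ e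
      · exact Or.inl hall
      · right
        push Not at hall
        obtain ⟨l, hl, hlarge⟩ := hall
        refine Set.mem_biUnion (Finset.mem_coe.2 (Finset.mem_range.2 hl)) ?_
        change M < |X2 (i + l * ((k : ℕ) + 1 : ℤ)) ω|
        refine lt_of_lt_of_le ?_ (le_abs_self _)
        have hobs := hω.observation (i + l * ((k : ℕ) + 1 : ℤ))
        have hσl := hω.pow_mul_le hθ hσ k i l
        have hpow : θ.β k ^ L ≤ θ.β k ^ l := pow_le_pow_of_le_one hk0.le hk1 hl.le
        rw [hobs]
        calc M ≤ M₀ := le_max_left _ _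
          _ < σ2 i ω * (e * θ.β k ^ L) := hlt
          _ ≤ σ2 i ω * (e * θ.β k ^ l) := by
            have := hσ i
            gcongr
          _ = e * (θ.β k ^ l * σ2 i ω) := by ring
          _ ≤ ζ (i + l * ((k : ℕ) + 1 : ℤ)) ω ^ 2 * σ2 (i + l * ((k : ℕ) + 1 : ℤ)) ω :=
            mul_le_mul hlarge.le hσl (mul_nonneg (pow_nonneg hk0.le _) (hσ i)) (sq_nonneg _)
    calc _ ≤ _ := hsub
      _ ≤ ε / 2 + L * (ε / 2 / (L + 1 : ℕ)) := by
          refine (measure_union_le _ _).trans (add_le_add ?_ ?_)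
          · rw [hζ.measure_forall_mem hinj hT]; exact hL.le
          · refine (measure_biUnion_finset_le _ _).trans ?_
            refine (Finset.sum_le_sum fun l _ => hM _).trans ?_
            rw [Finset.sum_const, Finset.card_range, nsmul_eq_mul]
      _ ≤ ε / 2 + (L + 1 : ℕ) * (ε / 2 / (L + 1 : ℕ)) := by
          gcongr; omega
      _ ≤ ε / 2 + ε / 2 := by
          gcongr
          exact ENNReal.mul_div_le
      _ = ε := ENNReal.add_halves ε

theorem norm_stateOf_le (X σ : ℤ → ℝ) (i : ℤ) :
    ‖Param.stateOf r s X σ i‖ ≤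
      ∑ j : Fin r, |X (i - (j : ℕ))| + ∑ k : Fin s, |σ (i - (k : ℕ))| := by
  have h1 : 0 ≤ ∑ j : Fin r, |X (i - (j : ℕ))| := Finset.sum_nonneg fun _ _ => abs_nonneg _
  have h2 : 0 ≤ ∑ k : Fin s, |σ (i - (k : ℕ))| := Finset.sum_nonneg fun _ _ => abs_nonneg _
  refine (pi_norm_le_iff_of_nonneg (add_nonneg h1 h2)).2 fun b => ?_
  rcases b with j | k
  · have := Finset.single_le_sum (f := fun j : Fin r => |X (i - (j : ℕ))|)
      (fun _ _ => abs_nonneg _) (Finset.mem_univ j)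
    simp only [Param.stateOf, Sum.elim_inl, Real.norm_eq_abs]
    linarith
  · have := Finset.single_le_sum (f := fun k : Fin s => |σ (i - (k : ℕ))|)
      (fun _ _ => abs_nonneg _) (Finset.mem_univ k)
    simp only [Param.stateOf, Sum.elim_inr, Real.norm_eq_abs]
    linarith

theorem IsTightFamily.norm_stateOf {X σ : ℤ → Ω → ℝ} (hX : IsTightFamily P X)
    (hσ : IsTightFamily P σ) :
    IsTightFamily P fun i ω => ‖Param.stateOf r s (fun i => X i ω) (fun i => σ i ω) i‖ := by
  have ht : IsTightFamily P fun i ω =>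
      ∑ j : Fin r, |X (i - (j : ℕ)) ω| + ∑ k : Fin s, |σ (i - (k : ℕ)) ω| :=
    (IsTightFamily.sum _ fun j : Fin r => (hX.shift (j : ℕ)).abs).add
      (IsTightFamily.sum _ fun k : Fin s => (hσ.shift (k : ℕ)).abs)
  refine ht.mono fun i => ae_of_all _ fun ω => ?_
  rw [abs_of_nonneg (norm_nonneg _)]
  exact (norm_stateOf_le _ _ i).trans (le_abs_self _)

/-- Two solutions with stationary observations agree almost surely. -/
theorem IsGarchSolution.ae_eq [IsProbabilityMeasure P] (hζ : IsInnovation P ζ) (hθ : θ.IsNonneg)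
    (hβ : ∑ k, θ.β k < 1) {ρ : ℝ} (hρ0 : 0 < ρ) (hρ1 : ρ < 1)
    (hρ : Tendsto (fun n : ℕ => seqLaw (P.map (ζ 0)) {y | ρ ^ n ≤ entrySum (θ.pastProd y n)})
      atTop (𝓝 0)) {X2 σ2 X2' σ2' : ℤ → Ω → ℝ} (h : IsGarchSolution P ζ θ X2 σ2)
    (hX : IsStrictlyStationary P X2) (h' : IsGarchSolution P ζ θ X2' σ2')
    (hX' : IsStrictlyStationary P X2') (i : ℤ) : X2 i =ᵐ[P] X2' i ∧ σ2 i =ᵐ[P] σ2' i := by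
  have htX := IsTightFamily.of_isStrictlyStationary h.aemeasurable_X2 hX
  have htX' := IsTightFamily.of_isStrictlyStationary h'.aemeasurable_X2 hX'
  set Z : ℤ → Ω → Fin r ⊕ Fin s → ℝ :=
    fun i ω => Param.stateOf r s (fun i => X2 i ω) (fun i => σ2 i ω) i with hZ
  set Z' : ℤ → Ω → Fin r ⊕ Fin s → ℝ :=
    fun i ω => Param.stateOf r s (fun i => X2' i ω) (fun i => σ2' i ω) i with hZ'
  have htD : IsTightFamily P fun i ω => ‖Z i ω - Z' i ω‖ := by
    refine ((htX.norm_stateOf (r := r) (s := s)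
      (h.isTightFamily_volatility hζ hθ hβ htX)).add (htX'.norm_stateOf (r := r) (s := s)
        (h'.isTightFamily_volatility hζ hθ hβ htX'))).mono fun i => ae_of_all _ fun ω => ?_
    rw [abs_of_nonneg (norm_nonneg _)]
    exact (norm_sub_le _ _).trans (le_abs_self _)
  -- A factor vanishing in probability times a tight one vanishes in probability; no independence
  -- between them is needed.
  have hsmall : ∀ i, ∀ δ : ℝ, 0 < δ → P {ω | δ < ‖Z i ω - Z' i ω‖} = 0 := by
    intro i δ hδ
    refine le_antisymm (le_of_forall_pos_le_add fun ε hε => ?_) zero_le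
    rw [zero_add]
    have hε2 : 0 < ε / 2 := ENNReal.half_pos hε.ne'
    obtain ⟨M, hM⟩ := htD (ε / 2) hε2
    set M₁ : ℝ := max M 1 with hM₁
    have hM₁0 : 0 < M₁ := lt_of_lt_of_le one_pos (le_max_right _ _)
    obtain ⟨n, hn, hpow⟩ := ((hρ.eventually_lt_const hε2).and
      ((tendsto_pow_atTop_nhds_zero_of_lt_one hρ0.le hρ1).eventually_lt_const
        (div_pos hδ hM₁0))).exists
    have hms : MeasurableSet {y : ℕ → ℝ | ρ ^ n ≤ entrySum (θ.pastProd y n)} :=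
      measurableSet_le measurable_const (θ.measurable_entrySum_pastProd n)
    rw [← hζ.map_past i, Measure.map_apply (hζ.measurable_past_path i) hms] at hn
    calc P {ω | δ < ‖Z i ω - Z' i ω‖}
        ≤ P ((fun ω => past (fun n => ζ n ω) i) ⁻¹'
            {y : ℕ → ℝ | ρ ^ n ≤ entrySum (θ.pastProd y n)} ∪
              {ω | M < |‖Z (i - n) ω - Z' (i - n) ω‖|}) := by
          refine measure_mono_ae ?_
          filter_upwards [h.ae_isPathSolution, h'.ae_isPathSolution] with ω hω hω' hlt
          by_contra hcon
          have hcon' := not_or.1 hcon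
          have h1 : entrySum (θ.pastProd (past (fun n => ζ n ω) i) n) < ρ ^ n :=
            not_le.1 hcon'.1
          have h2 : ‖Z (i - n) ω - Z' (i - n) ω‖ ≤ M := by
            have h4 : ¬ M < |‖Z (i - n) ω - Z' (i - n) ω‖| := hcon'.2
            rwa [not_lt, abs_of_nonneg (norm_nonneg _)] at h4
          have h3 : δ < ‖Z i ω - Z' i ω‖ := hlt
          rw [hZ, hZ'] at h3
          simp only at h3
          rw [hω.stateOf_sub_eq hω' n i] at h3
          refine absurd h3 (not_lt.2 ((norm_mulVec_le _ _).trans ?_))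
          calc _ ≤ δ / M₁ * M₁ := mul_le_mul (h1.le.trans hpow.le)
                (h2.trans (le_max_left _ _)) (norm_nonneg _) (by positivity)
            _ = δ := div_mul_cancel₀ _ hM₁0.ne'
      _ ≤ ε / 2 + ε / 2 := (measure_union_le _ _).trans (add_le_add hn.le (hM _))
      _ = ε := ENNReal.add_halves ε
  have hzero : ∀ i, ∀ᵐ ω ∂P, Z i ω = Z' i ω := by
    intro i
    have hall : ∀ᵐ ω ∂P, ∀ m : ℕ, ‖Z i ω - Z' i ω‖ ≤ 1 / ((m : ℝ) + 1) := by
      refine ae_all_iff.2 fun m => ?_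
      have := hsmall i (1 / ((m : ℝ) + 1)) (by positivity)
      rw [ae_iff]
      simpa only [not_le] using this
    filter_upwards [hall] with ω hω
    rw [← sub_eq_zero, ← norm_le_zero_iff]
    exact ge_of_tendsto' tendsto_one_div_add_atTop_nhds_zero_nat hω
  -- Volatility is read off from the previous state, since for s = 0 the state has no volatility
  -- entry.
  have hσ : ∀ᵐ ω ∂P, σ2 i ω = σ2' i ω := by
    filter_upwards [h.ae_isPathSolution, h'.ae_isPathSolution, hzero (i - 1)] with ω hω hω' hz
    have e1 := hω.volatility_eq i
    have e2 := hω'.volatility_eq i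
    simp only [hZ, hZ'] at hz
    rw [e1, e2, hz]
  refine ⟨?_, hσ⟩
  filter_upwards [h.observation i, h'.observation i, hσ] with ω e1 e2 e3
  rw [e1, e2, e3]

end Uniqueness

/-! ### The spectral radius of B(θ). -/

section SpectralRadius

variable {r s : ℕ} {θ : Param r s}

/-- Every complex eigenvalue of `B(θ)` has modulus less than one. -/
theorem Param.norm_lt_one_of_mem_spectrum_companionB (hnn : ∀ k, 0 ≤ θ.β k)
    (hβ : ∑ k, θ.β k < 1) {z : ℂ}
    (hz : z ∈ spectrum ℂ (θ.companionB.map (fun x : ℝ => (x : ℂ)))) : ‖z‖ < 1 := by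
  rw [spectrum.mem_iff, Matrix.isUnit_iff_isUnit_det, isUnit_iff_ne_zero, not_not] at hz
  obtain ⟨v, hv0, hv⟩ := Matrix.exists_mulVec_eq_zero_iff.2 hz
  have hrow : ∀ i, z * v i = ∑ j, (θ.companionB i j : ℂ) * v j := by
    intro i
    have h := congrFun hv i
    rw [Matrix.sub_mulVec, Pi.sub_apply, Pi.zero_apply, sub_eq_zero, Algebra.algebraMap_eq_smul_one,
      Matrix.smul_mulVec, Matrix.one_mulVec, Pi.smul_apply, smul_eq_mul] at h
    rw [h]
    rfl
  by_contra! hcon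
  have hs : 0 < s := by
    by_contra hs
    obtain rfl : s = 0 := by omega
    exact hv0 (Subsingleton.elim _ _)
  -- The lower rows say z v_{n+1} = v_n. With |z| ≥ 1 the moduli decrease, so v_0 is the largest
  -- entry, and the first row then contradicts ∑ β_k < 1.
  have hstep : ∀ (n : ℕ) (hn : n < s), ‖v ⟨n, hn⟩‖ ≤ ‖v ⟨0, hs⟩‖ := by
    intro n
    induction n with
    | zero => intro _; exact le_rfl
    | succ n ih =>
      intro hn
      refine le_trans ?_ (ih (by omega))
      have h := hrow ⟨n + 1, hn⟩
      rw [Finset.sum_eq_single ⟨n, by omega⟩] at h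
      · have h1 : ((θ.companionB ⟨n + 1, hn⟩ ⟨n, by omega⟩ : ℝ) : ℂ) = 1 := by
          simp [companionB]
        rw [h1, one_mul] at h
        rw [← h, norm_mul]
        exact le_mul_of_one_le_left (norm_nonneg _) hcon
      · intro j _ hj
        have hne : ¬ n = (j : ℕ) := fun h => hj (Fin.ext h.symm)
        simp [companionB, hne]
      · exact fun h => absurd (Finset.mem_univ _) h
  have h0 := hrow ⟨0, hs⟩
  have hle : ‖z * v ⟨0, hs⟩‖ ≤ (∑ k, θ.β k) * ‖v ⟨0, hs⟩‖ := by
    rw [h0, Finset.sum_mul]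
    refine (norm_sum_le _ _).trans (Finset.sum_le_sum fun j _ => ?_)
    have h1 : θ.companionB ⟨0, hs⟩ j = θ.β j := by simp [companionB]
    rw [h1, norm_mul, Complex.norm_real, Real.norm_of_nonneg (hnn j)]
    exact mul_le_mul_of_nonneg_left (hstep j j.isLt) (hnn j)
  have hpos : 0 < ‖v ⟨0, hs⟩‖ := by
    refine lt_of_le_of_ne (norm_nonneg _) fun h => hv0 ?_
    funext j
    have := hstep j j.isLt
    rw [← h] at this
    exact norm_le_zero_iff.1 this
  rw [norm_mul] at hle
  have h2 : 1 * ‖v ⟨0, hs⟩‖ ≤ ‖z‖ * ‖v ⟨0, hs⟩‖ := mul_le_mul_of_nonneg_right hcon hpos.le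
  have h3 : (∑ k, θ.β k) * ‖v ⟨0, hs⟩‖ < 1 * ‖v ⟨0, hs⟩‖ := mul_lt_mul_of_pos_right hβ hpos
  linarith

/-- The spectrum is finite, so the strict bound on each eigenvalue survives the supremum; an empty
spectrum gives 0. -/
theorem Param.spectralRadius_companionB_lt_one (hnn : ∀ k, 0 ≤ θ.β k) (hβ : ∑ k, θ.β k < 1) :
    spectralRadius ℂ (θ.companionB.map (fun x : ℝ => (x : ℂ))) < 1 := by
  have hfin := Matrix.finite_spectrum (θ.companionB.map (fun x : ℝ => (x : ℂ)))
  have heq : spectralRadius ℂ (θ.companionB.map (fun x : ℝ => (x : ℂ))) =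
      hfin.toFinset.sup fun z => (‖z‖₊ : ENNReal) := by
    rw [Finset.sup_eq_iSup]
    simp [spectralRadius]
  rw [heq, Finset.sup_lt_iff (by simp)]
  intro z hz
  have := norm_lt_one_of_mem_spectrum_companionB hnn hβ (hfin.mem_toFinset.1 hz)
  exact_mod_cast this

end SpectralRadius

/-! ### The causal solution and the conclusion. -/

section Existence

variable {r s : ℕ} {Ω : Type*} [MeasurableSpace Ω] {P : Measure Ω} {ζ : ℤ → Ω → ℝ}
  {θ : Param r s}

theorem isGarchSolution_causal (hζ : IsInnovation P ζ) (hθ : θ.IsNonneg)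
    (hgood : ∀ᵐ ω ∂P, ∀ i : ℤ, θ.stateBound (past (fun n => ζ n ω) i) < ⊤) :
    IsGarchSolution P ζ θ (causal ζ θ.obsFun) (fun i => causal ζ θ.volFun (i - 1)) where
  aemeasurable_X2 i := (θ.measurable_obsFun.comp (hζ.measurable_past_path i)).aemeasurable
  aemeasurable_σ2 i := (θ.measurable_volFun.comp (hζ.measurable_past_path (i - 1))).aemeasurable
  nonneg i := ae_of_all _ fun ω => Param.volFun_nonneg hθ _
  observation i := by
    filter_upwards [hgood] with ω hω
    exact (Param.isPathSolution_causal hθ hω).observation i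
  volatility i := by
    filter_upwards [hgood] with ω hω
    exact (Param.isPathSolution_causal hθ hω).volatility i

/-- Both components are functionals of the same past, the volatility through `drop 1`, so joint
stationarity is that of a single functional. -/
theorem isStrictlyStationary_causal [IsProbabilityMeasure P] (hζ : IsInnovation P ζ) :
    IsStrictlyStationary P
      (fun i ω => (causal ζ θ.obsFun i ω, causal ζ θ.volFun (i - 1) ω)) := by
  have h := hζ.isStrictlyStationary_comp (g := fun y => (θ.obsFun y, θ.volFun (drop 1 y)))
    (θ.measurable_obsFun.prodMk (θ.measurable_volFun.comp (measurable_drop 1)))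
  simp only [drop_past, Nat.cast_one] at h
  exact h

end Existence

end GarchModel

theorem proposition3p2 {Ω : Type*} [MeasurableSpace Ω] (P : Measure Ω) [IsProbabilityMeasure P]
    (r s : ℕ) (ζ : ℤ → Ω → ℝ) (αmin : ℝ) (Θ : Set (GarchModel.Param r s))
    (θstar : GarchModel.Param r s)
    (hA : GarchModel.StandingAssumption P ζ αmin Θ θstar)
    (θ : GarchModel.Param r s) (hθ : θ ∈ Θ) :
    (∃ H G : (ℕ → ℝ) → ℝ, Measurable H ∧ Measurable G ∧
      -- (i) existence: `X_i² = H(ℱ_i)`, `σ_i² = G(ℱ_{i-1})` is a strictly stationary solution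
      GarchModel.IsGarchSolution P ζ θ
        (GarchModel.causal ζ H) (fun i => GarchModel.causal ζ G (i - 1)) ∧
      GarchModel.IsStrictlyStationary P
        (fun i ω => (GarchModel.causal ζ H i ω, GarchModel.causal ζ G (i - 1) ω)) ∧
      -- (i) uniqueness, among all solutions for which `X_i²` is strictly stationary
      (∀ X2 σ2 : ℤ → Ω → ℝ, GarchModel.IsGarchSolution P ζ θ X2 σ2 →
        GarchModel.IsStrictlyStationary P X2 →
        ∀ i, X2 i =ᵐ[P] GarchModel.causal ζ H i ∧
          σ2 i =ᵐ[P] GarchModel.causal ζ G (i - 1)) ∧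
      -- (ii) moments and geometric decay of the functional dependence measure
      (∃ q : ℝ, 0 < q ∧
        eLpNorm (GarchModel.causal ζ H 0) (ENNReal.ofReal q) P < ⊤ ∧
        ∃ c : ℝ, 0 < c ∧ c < 1 ∧ ∃ C : ℝ, ∀ k : ℕ,
          GarchModel.functionalDependence P ζ H q k ≤ ENNReal.ofReal (C * c ^ k))) ∧
    -- (iii)
    spectralRadius ℂ (θ.companionB.map (fun x : ℝ => (x : ℂ))) < 1 := by
  have hζ := hA.innovation
  have := hζ.isProbabilityMeasure_law
  obtain ⟨ha0, hα, hβ, -, ⟨g, hg, hg0⟩, hβ1⟩ := hA.subset hθ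
  have hnn : θ.IsNonneg := ⟨ha0, hα, hβ⟩
  obtain ⟨ρ, hρ0, hρ1, hρ⟩ := GarchModel.Param.exists_tendsto_seqLaw_entrySum hζ hg hg0
  obtain ⟨q, hq0, hq1, C, c, hC, hc0, hc1, hmom⟩ :=
    θ.exists_prodMoment_le_geometric hζ.lintegral_sq hρ0 hρ1 hρ
  have hfin := GarchModel.Param.lintegral_stateBound_rpow_lt_top hζ.lintegral_sq hq0 hq1 hC hc0
    hc1 hmom
  have hgood := GarchModel.Param.ae_past_of_ae_seqLaw hζ
    (GarchModel.Param.ae_stateBound_lt_top hq0 hfin)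
  have hstate := GarchModel.Param.stateMoment_lt_top hq0 hq1 hfin
  have hsol := GarchModel.isGarchSolution_causal hζ hnn hgood
  refine ⟨⟨θ.obsFun, θ.volFun, θ.measurable_obsFun, θ.measurable_volFun, hsol,
    GarchModel.isStrictlyStationary_causal hζ, fun X2 σ2 h hX i => ?_, q, hq0,
    GarchModel.Param.eLpNorm_obsFun_lt_top hζ hq0 hq1 hgood hstate,
    GarchModel.Param.exists_functionalDependence_le hζ hnn hq0 hq1 hgood hstate hC hc0 hc1 hmom⟩,
    GarchModel.Param.spectralRadius_companionB_lt_one hβ hβ1⟩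
  exact h.ae_eq hζ hnn hβ1 hρ0 hρ1 hρ hX hsol (hζ.isStrictlyStationary_comp θ.measurable_obsFun) i
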